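/- Let $(E,[\cdot,\cdot]_E,\sigma)$ be a (smooth) Lie algebroid over a smooth finite-dimensional manifold $M$, where $\pi:E\to M$ is a vector bundle of finite rank, and let $\tau:E^*\to M$ be the dual bundle. Let $$\mathcal T_wE=\{(u,v)\in E_{\pi(w)}\times T_wE : \sigma(u)=T_w\pi(v)\},\qquad \mathcal T_\mu E^*=\{(u,v)\in E_{\tau(\mu)}\times T_\mu E^* : \sigma(u)=T_\mu\tau(v)\}$$ be the fibres of the prolongations $\mathcal TE\to E$ and $\mathcal TE^*\to E^*$ of $E$ over $\pi$ and over $\tau$, with their Lie algebroid brackets and with the anchor $(u,v)\mapsto v$; the vertical subbundle of each of them is $\{u=0\}$. On $\mathcal TE$ let $J(u,v)=(0,u^v)$ be the vertical endomorphism and $C(w)=(0,w^v)$ the Euler section, where $a^v$ denotes the vertical lift; a semispray is a smooth section $S$ of $\mathcal TE$ with $JS=C$. On $\mathcal TE^*$ let $\theta_E(\mu)(u,v)=\mu(u)$ and $\omega_E=-d^E\theta_E$. A connection on $\mathcal TE$ or $\mathcal TE^*$ is a smooth bundle endomorphism $\mathcal N$ over the identity with $\mathcal N^2=\mathrm{Id}$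 and $\ker(\mathrm{Id}+\mathcal N)$ the vertical subbundle. For an endomorphism $K$ and a section $\rho$ put $(\mathcal L_\rho K)(\nu)=[\rho,K\nu]-K[\rho,\nu]$. Let $\mathcal H\in C^\infty(E^*)$ be a hyperregular Hamiltonian, i.e. its fibre derivative $\Phi:E^*\to E$, given in local coordinates by $x^i=q^i$, $y^\alpha=\partial\mathcal H/\partial\mu_\alpha$, is a (global) diffeomorphism, and let $\Phi_*(u,v)=(u,T\Phi(v))$ be the induced map $\mathcal TE^*\to\mathcal TE$. Let $g$ be the pseudo-Riemannian metric on the vertical subbundle of $\mathcal TE^*$ with matrix $g^{\alpha\beta}=\partial^2\mathcal H/\partial\mu_\alpha\partial\mu_\beta$, and let $\mathcal J$ be the almost tangent structure induced by $\mathcal H$: the smooth endomorphism of $\mathcal TE^*$ with $\mathcal J^2=0$ whose image and kernel are the vertical subbundle, with $\omega_E(\mathcal J\rho_1,\rho_2)=\omega_E(\mathcal J\rho_2,\rho_1)$ and $g(\mathcal J\rho_1,\mathcal J\rho_2)=-\omega_E(\mathcal J\rho_1,\rho_2)$ for all sections $\rho_1,\rho_2$. Let $\rho$ be any smooth section of $\mathcal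 TE^*$ induced by $\mathcal H$, i.e. one whose $E$-component at each $\mu\in E^*$ is $\Phi(\mu)$; locally $\rho=\frac{\partial\mathcal H}{\partial\mu_\alpha}\mathcal Q_\alpha+\rho_\alpha\mathcal P^\alpha$ with arbitrary $\rho_\alpha$, where $\mathcal Q_\alpha=(s_\alpha,\sigma^i_\alpha\partial/\partial q^i)$ and $\mathcal P^\alpha=(0,\partial/\partial\mu_\alpha)$ for a local frame $(s_\alpha)$ of $E$. Then $\rho$ is $\mathcal J$-regular, i.e. $\mathcal J[\rho,\mathcal J\nu]=-\mathcal J\nu$ for every section $\nu$ of $\mathcal TE^*$, and $\Phi_*\rho=\Phi_*\circ\rho\circ\Phi^{-1}$ is a semispray on $\mathcal TE$. Moreover $\mathcal N=-\mathcal L_\rho\mathcal J$ is a connection on $\mathcal TE^*$, $N=-\mathcal L_{\Phi_*\rho}J$ is a connection on $\mathcal TE$, and $N$ is the image of $\mathcal N$ under $\Phi$, that is, $N\circ\Phi_*=\Phi_*\circ\mathcal N$. -/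

import Mathlib

open Bundle Filter Topology VectorField
open scoped Manifold ContDiff

noncomputable section

/-! ## Lie algebroids -/

section DirDeriv

variable {EP : Type*} [NormedAddCommGroup EP] [NormedSpace ℝ EP]
  {HP : Type*} [TopologicalSpace HP] (IP : ModelWithCorners ℝ EP HP)
  {P : Type*} [TopologicalSpace P] [ChartedSpace HP P]
  {W : Type*} [NormedAddCommGroup W] [NormedSpace ℝ W]

/-- The derivative `v(f)` of a vector-valued function `f` in the direction of a tangent vector. -/
def dirDeriv (f : P → W) (w : P) (v : TangentSpace IP w) : W := mfderiv IP 𝓘(ℝ, W) f w v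

end DirDeriv

section Algebroid

variable {EM : Type*} [NormedAddCommGroup EM] [NormedSpace ℝ EM]
  {M : Type*} [TopologicalSpace M] [ChartedSpace EM M] [IsManifold 𝓘(ℝ, EM) ∞ M]
  {F : Type*} [NormedAddCommGroup F] [NormedSpace ℝ F]
  {E : M → Type*} [TopologicalSpace (TotalSpace F E)]
  [∀ x, AddCommGroup (E x)] [∀ x, Module ℝ (E x)] [∀ x, TopologicalSpace (E x)]
  [FiberBundle F E] [VectorBundle ℝ F E]

variable (EM F E) in
/-- A Lie algebroid structure on the smooth vector bundle `E → M`: a Lie bracket on the space of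
smooth sections `Γ(E)` and a smooth bundle map `σ : E → TM` (the anchor) over the identity which
induces a Lie algebra homomorphism `Γ(E) → 𝔛(M)` and satisfies the Leibniz rule. -/
structure LieAlgebroid where
  /-- the anchor -/
  anchor : ∀ x, E x →ₗ[ℝ] TangentSpace 𝓘(ℝ, EM) x
  contMDiff_anchor : ContMDiff (𝓘(ℝ, EM).prod 𝓘(ℝ, F)) 𝓘(ℝ, EM).tangent ∞
    (fun e : TotalSpace F E ↦ (⟨e.proj, anchor e.proj e.2⟩ : TangentBundle 𝓘(ℝ, EM) M))
  /-- the bracket of smooth sections -/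
  bracket : Cₛ^∞⟮𝓘(ℝ, EM); F, E⟯ → Cₛ^∞⟮𝓘(ℝ, EM); F, E⟯ → Cₛ^∞⟮𝓘(ℝ, EM); F, E⟯
  bracket_add : ∀ r s t, bracket r (s + t) = bracket r s + bracket r t
  bracket_smul : ∀ (c : ℝ) s t, bracket s (c • t) = c • bracket s t
  bracket_skew : ∀ s t, bracket s t = -bracket t s
  jacobi : ∀ r s t,
    bracket r (bracket s t) + bracket s (bracket t r) + bracket t (bracket r s) = 0
  anchor_bracket : ∀ s t x, anchor x (bracket s t x) =
    mlieBracket 𝓘(ℝ, EM) (fun y ↦ anchor y (s y)) (fun y ↦ anchor y (t y)) x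
  leibniz : ∀ (s t : Cₛ^∞⟮𝓘(ℝ, EM); F, E⟯) (f : M → ℝ) (hf : ContMDiff 𝓘(ℝ, EM) 𝓘(ℝ, ℝ) ∞ f) (x : M),
    bracket s ⟨f • ⇑t, hf.smul_section t.contMDiff⟩ x =
      f x • bracket s t x + dirDeriv 𝓘(ℝ, EM) f x (anchor x (s x)) • t x

/-- Every vector of `E` is the value of a smooth section of `E` which is constant near its base
point in the preferred local trivialization there. -/
theorem exists_section_eventuallyEq_extend [FiniteDimensional ℝ EM] [T2Space M]
    [ContMDiffVectorBundle ∞ F E 𝓘(ℝ, EM)] {x : M} (u : E x) :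
    ∃ s : Cₛ^∞⟮𝓘(ℝ, EM); F, E⟯, ∀ᶠ y in 𝓝 x, s y = FiberBundle.extend F u y := by
  obtain ⟨U, hU, hs⟩ := FiberBundle.exists_contMDiffOn_extend (k := ∞) 𝓘(ℝ, EM) F u
  obtain ⟨f, -, hf⟩ := (SmoothBumpFunction.nhds_basis_tsupport (I := 𝓘(ℝ, EM)) x).mem_iff.1
    (interior_mem_nhds.2 hU)
  refine ⟨⟨(f : M → ℝ) • FiberBundle.extend F u, ContMDiffOn.smul_section_of_tsupport
    f.contMDiff.contMDiffOn isOpen_interior hf (hs.mono interior_subset)⟩, ?_⟩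
  filter_upwards [f.eventuallyEq_one] with y hy
  simp [hy]

namespace LieAlgebroid

/-- A smooth section of `E` through `u` which is constant near the base point of `u` in the
preferred local trivialization there. -/
def localConst [FiniteDimensional ℝ EM] [T2Space M]
    [ContMDiffVectorBundle ∞ F E 𝓘(ℝ, EM)] {x : M} (u : E x) :
    Cₛ^∞⟮𝓘(ℝ, EM); F, E⟯ :=
  (exists_section_eventuallyEq_extend (EM := EM) (F := F) u).choose

theorem localConst_eventuallyEq [FiniteDimensional ℝ EM] [T2Space M]
    [ContMDiffVectorBundle ∞ F E 𝓘(ℝ, EM)] {x : M} (u : E x) :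
    ∀ᶠ y in 𝓝 x, localConst (EM := EM) (F := F) u y = FiberBundle.extend F u y :=
  (exists_section_eventuallyEq_extend (EM := EM) (F := F) u).choose_spec

/-! ## The prolongation of a Lie algebroid over a smooth map -/

variable {EP : Type*} [NormedAddCommGroup EP] [NormedSpace ℝ EP]
  {HP : Type*} [TopologicalSpace HP] (IP : ModelWithCorners ℝ EP HP)
  {P : Type*} [TopologicalSpace P] [ChartedSpace HP P] [IsManifold IP ∞ P]

/-- The fibre over `w ∈ P` of the prolongation of `E` over `p : P → M`:
`{(u, v) ∈ E_{p w} × T_w P | σ u = T_w p v}`. -/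
def prolFiber (A : LieAlgebroid EM F E) (p : P → M) (w : P) :
    Submodule ℝ (E (p w) × TangentSpace IP w) :=
  LinearMap.eqLocus
    (A.anchor (p w) ∘ₗ LinearMap.fst ℝ (E (p w)) (TangentSpace IP w))
    ((mfderiv IP 𝓘(ℝ, EM) p w : TangentSpace IP w →ₗ[ℝ] TangentSpace 𝓘(ℝ, EM) (p w)) ∘ₗ
      LinearMap.snd ℝ (E (p w)) (TangentSpace IP w))

variable {IP}

/-- A section of the prolongation is smooth if both of its components, the section of `E` along `p`
and the vector field on `P`, are smooth. -/
structure IsSmooth (A : LieAlgebroid EM F E) {p : P → M} (ρ : ∀ w, A.prolFiber IP p w) : Prop where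
  fst : ContMDiff IP (𝓘(ℝ, EM).prod 𝓘(ℝ, F)) ∞
    (fun w ↦ (⟨p w, (ρ w).1.1⟩ : TotalSpace F E))
  snd : ContMDiff IP IP.tangent ∞ (fun w ↦ (⟨w, (ρ w).1.2⟩ : TangentBundle IP P))

variable [FiniteDimensional ℝ EM] [T2Space M]
  [ContMDiffVectorBundle ∞ F E 𝓘(ℝ, EM)]

/-- The `E`-component at `w` of the bracket of two sections `(X, U)`, `(Y, W)` of the prolongation.
If `s_α` is the frame of `E` near `p w` which is constant in the preferred local trivialization,
and `X = X^α (s_α ∘ p)`, `Y = Y^α (s_α ∘ p)`, this is the value at `w` of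
`(U(Y^α) - W(X^α)) s_α + X^α Y^β [s_α, s_β]`, as forced by the Leibniz rule. -/
def bracketFst (A : LieAlgebroid EM F E) {p : P → M} (ρ₁ ρ₂ : ∀ w, A.prolFiber IP p w) (w : P) :
    E (p w) :=
  (trivializationAt F E (p w)).symm (p w)
    (dirDeriv IP (fun z ↦ (trivializationAt F E (p w) ⟨p z, (ρ₂ z).1.1⟩).2) w (ρ₁ w).1.2 -
      dirDeriv IP (fun z ↦ (trivializationAt F E (p w) ⟨p z, (ρ₁ z).1.1⟩).2) w (ρ₂ w).1.2) +
  A.bracket (localConst (ρ₁ w).1.1) (localConst (ρ₂ w).1.1) (p w)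

open Classical in
/-- The Lie algebroid bracket of sections of the prolongation; the `P`-component is the Lie bracket
of vector fields. On smooth sections the pair lies in the fibre of the prolongation, the bracket
satisfies the Leibniz rule with respect to the anchor `(u, v) ↦ v`, and it is given by
`[(X ∘ p, U), (Y ∘ p, W)] = ([X, Y] ∘ p, [U, W])` on pairs with `X, Y ∈ Γ(E)`; if `p` is the
projection of a vector bundle, these properties determine it.
The value `0` is only used for sections which are not smooth. -/
def prolBracket (A : LieAlgebroid EM F E) {p : P → M} (ρ₁ ρ₂ : ∀ w, A.prolFiber IP p w) (w : P) :
    A.prolFiber IP p w :=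
  if h : (A.bracketFst ρ₁ ρ₂ w,
      mlieBracket IP (fun z ↦ (ρ₁ z).1.2) (fun z ↦ (ρ₂ z).1.2) w) ∈ A.prolFiber IP p w
  then ⟨_, h⟩ else 0

/-- The Lie derivative `ℒ_ρ K` of an endomorphism `K` of the prolongation, as an operator on
sections: `(ℒ_ρ K)(ν) = [ρ, K ν] - K [ρ, ν]`. -/
def lieDerivative (A : LieAlgebroid EM F E) {p : P → M} (ρ : ∀ w, A.prolFiber IP p w)
    (K : ∀ w, A.prolFiber IP p w → A.prolFiber IP p w) (ν : ∀ w, A.prolFiber IP p w) (w : P) :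
    A.prolFiber IP p w :=
  A.prolBracket ρ (fun z ↦ K z (ν z)) w - K w (A.prolBracket ρ ν w)

/-- A nonlinear (Ehresmann) connection on the prolongation: a smooth bundle endomorphism `N` over
the identity with `N² = Id` and `ker (Id + N) = V`, the vertical bundle `{(u, v) | u = 0}`. -/
structure IsConnection (A : LieAlgebroid EM F E) {p : P → M}
    (N : ∀ w, A.prolFiber IP p w →ₗ[ℝ] A.prolFiber IP p w) : Prop where
  smooth : ∀ ν : ∀ w, A.prolFiber IP p w, A.IsSmooth ν → A.IsSmooth (fun w ↦ N w (ν w))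
  sq : ∀ w, N w ∘ₗ N w = LinearMap.id
  ker : ∀ w a, a ∈ LinearMap.ker (LinearMap.id + N w) ↔ a.1.1 = 0

end LieAlgebroid

/-! ## Vertical lifts -/

variable {G : Type*} [NormedAddCommGroup G] [NormedSpace ℝ G]
  {V : M → Type*} [TopologicalSpace (TotalSpace G V)]
  [∀ x, AddCommGroup (V x)] [∀ x, Module ℝ (V x)] [∀ x, TopologicalSpace (V x)]
  [FiberBundle G V] [VectorBundle ℝ G V]

/-- The line `t ↦ w + t a` in the fibre of the vector bundle `V` through `w`. -/
def fiberLine (w : TotalSpace G V) (a : V w.proj) (t : ℝ) : TotalSpace G V :=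
  ⟨w.proj, w.2 + t • a⟩

variable (EM) in
/-- The vertical lift of `a ∈ V_x` to `w ∈ V_x`: the velocity at `t = 0` of `t ↦ w + t a`. -/
def vertLift (w : TotalSpace G V) (a : V w.proj) :
    TangentSpace (𝓘(ℝ, EM).prod 𝓘(ℝ, G)) w :=
  (mfderiv 𝓘(ℝ, ℝ) (𝓘(ℝ, EM).prod 𝓘(ℝ, G)) (fiberLine w a) 0 (1 : ℝ) :)

theorem mfderiv_proj_vertLift (w : TotalSpace G V) (a : V w.proj) :
    mfderiv (𝓘(ℝ, EM).prod 𝓘(ℝ, G)) 𝓘(ℝ, EM) (TotalSpace.proj : TotalSpace G V → M) w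
      (vertLift EM w a) = 0 := by
  have h0 : fiberLine w a 0 = w := by simp [fiberLine]
  by_cases h : MDifferentiableAt 𝓘(ℝ, ℝ) (𝓘(ℝ, EM).prod 𝓘(ℝ, G)) (fiberLine w a) 0
  · have hp : MDifferentiableAt (𝓘(ℝ, EM).prod 𝓘(ℝ, G)) 𝓘(ℝ, EM)
        (TotalSpace.proj : TotalSpace G V → M) (fiberLine w a 0) :=
      (contMDiff_proj (n := 1) V).mdifferentiable one_ne_zero _
    have key : HasMFDerivAt 𝓘(ℝ, ℝ) 𝓘(ℝ, EM) (fun _ : ℝ ↦ w.proj) 0 _ :=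
      hp.hasMFDerivAt.comp (0 : ℝ) h.hasMFDerivAt
    have key1 := hasMFDerivAt_unique key (hasMFDerivAt_const (w.proj) (0 : ℝ))
    have key2 := DFunLike.congr_fun key1 (1 : ℝ)
    rw [h0] at key2
    exact key2
  · have : vertLift EM w a = 0 := by
      simp only [vertLift]
      rw [mfderiv_zero_of_not_mdifferentiableAt h]
      rfl
    rw [this]
    exact map_zero _

end Algebroid

/-! ## The prolongations over `E` and over the dual bundle -/

section Main

variable {EM : Type*} [NormedAddCommGroup EM] [NormedSpace ℝ EM] [FiniteDimensional ℝ EM]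
  {M : Type*} [TopologicalSpace M] [ChartedSpace EM M] [IsManifold 𝓘(ℝ, EM) ∞ M] [T2Space M]
  {F : Type*} [NormedAddCommGroup F] [NormedSpace ℝ F]
  {E : M → Type*} [TopologicalSpace (TotalSpace F E)]
  [∀ x, AddCommGroup (E x)] [∀ x, Module ℝ (E x)] [∀ x, TopologicalSpace (E x)]
  [FiberBundle F E] [VectorBundle ℝ F E] [ContMDiffVectorBundle ∞ F E 𝓘(ℝ, EM)]

variable (F E) in
/-- The total space of the dual bundle `E*`. -/
abbrev DualTotal : Type _ := TotalSpace (F →L[ℝ] ℝ) (fun x ↦ E x →L[ℝ] Bundle.Trivial M ℝ x)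

namespace LieAlgebroid

variable (A : LieAlgebroid EM F E)

/-- The fibre of `𝒯E` over `w ∈ E`. -/
abbrev TE (w : TotalSpace F E) : Type _ :=
  A.prolFiber (𝓘(ℝ, EM).prod 𝓘(ℝ, F)) (TotalSpace.proj : TotalSpace F E → M) w

/-- The fibre of `𝒯E*` over `μ ∈ E*`. -/
abbrev TEdual (μ : DualTotal F E) : Type _ :=
  A.prolFiber (𝓘(ℝ, EM).prod 𝓘(ℝ, F →L[ℝ] ℝ)) (TotalSpace.proj : DualTotal F E → M) μ

/-- The vertical element `(0, a^v)` of `𝒯E` at `w`. -/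
def vertE (w : TotalSpace F E) (a : E w.proj) : A.TE w :=
  ⟨(0, vertLift EM w a), by
    simp [prolFiber, mfderiv_proj_vertLift]⟩

/-- The vertical element `(0, α^v)` of `𝒯E*` at `μ`. -/
def vertDual (μ : DualTotal F E) (α : E μ.proj →L[ℝ] ℝ) : A.TEdual μ :=
  ⟨(0, vertLift EM μ α), by
    simp [prolFiber, mfderiv_proj_vertLift]⟩

/-- The vertical endomorphism `J` of `𝒯E`: `J(u, v) = (0, u^v)`. In a local frame
`J = 𝒳^α ⊗ 𝒱_α`; it sends complete lifts `(s, s^c)` to `(0, s^v)` and kills vertical lifts. -/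
def J (w : TotalSpace F E) (a : A.TE w) : A.TE w := A.vertE w a.1.1

/-- The Euler section `C` of `𝒯E`: `C(w) = (0, w^v)`. -/
def euler (w : TotalSpace F E) : A.TE w := A.vertE w w.2

/-- A semispray is a (smooth) section `S` of `𝒯E` with `J S = C`. -/
structure IsSemispray (S : ∀ w, A.TE w) : Prop where
  smooth : A.IsSmooth S
  J_apply : ∀ w, A.J w (S w) = A.euler w

/-- The Liouville section: `θ(μ)(u, v) = μ(u)`. -/
def liouville (μ : DualTotal F E) (a : A.TEdual μ) : ℝ := μ.2 a.1.1

/-- The canonical symplectic section `ω = -dθ`, evaluated on sections of `𝒯E*`, where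
`dθ(ρ₁, ρ₂) = ρ₁(θ(ρ₂)) - ρ₂(θ(ρ₁)) - θ([ρ₁, ρ₂])` and sections act on functions through
the anchor. -/
def omega (ρ₁ ρ₂ : ∀ μ, A.TEdual μ) (μ : DualTotal F E) : ℝ :=
  -(dirDeriv (𝓘(ℝ, EM).prod 𝓘(ℝ, F →L[ℝ] ℝ)) (fun z ↦ A.liouville z (ρ₂ z)) μ (ρ₁ μ).1.2 -
    dirDeriv (𝓘(ℝ, EM).prod 𝓘(ℝ, F →L[ℝ] ℝ)) (fun z ↦ A.liouville z (ρ₁ z)) μ (ρ₂ μ).1.2 -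
    A.liouville μ (A.prolBracket ρ₁ ρ₂ μ))

/-- An adapted almost tangent structure on `𝒯E*`: a smooth bundle endomorphism `K` over the
identity with `K² = 0` and `im K = ker K = V`, the vertical bundle. -/
structure IsAdapted (K : ∀ μ, A.TEdual μ →ₗ[ℝ] A.TEdual μ) : Prop where
  smooth : ∀ ν : ∀ μ, A.TEdual μ, A.IsSmooth ν → A.IsSmooth (fun μ ↦ K μ (ν μ))
  sq : ∀ μ, K μ ∘ₗ K μ = 0
  ker : ∀ μ a, a ∈ LinearMap.ker (K μ) ↔ a.1.1 = 0
  range : ∀ μ a, a ∈ LinearMap.range (K μ) ↔ a.1.1 = 0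

/-- A section `ρ` of `𝒯E*` is `K`-regular if `K [ρ, K ν] = -K ν` for all sections `ν`. -/
def IsRegular (K : ∀ μ, A.TEdual μ →ₗ[ℝ] A.TEdual μ) (ρ : ∀ μ, A.TEdual μ) : Prop :=
  ∀ ν : ∀ μ, A.TEdual μ, A.IsSmooth ν → ∀ μ,
    K μ (A.prolBracket ρ (fun z ↦ K z (ν z)) μ) = -K μ (ν μ)

end LieAlgebroid

/-- The second derivative of `H` along the fibre of `E*`, `∂²/∂r∂t H(μ + r α + t β)` at `r = t = 0`;
it is the matrix `∂²H/∂μ_α∂μ_β` in fibre coordinates. -/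
def fiberHessian (H : DualTotal F E → ℝ) (μ : DualTotal F E) (α β : E μ.proj →L[ℝ] ℝ) : ℝ :=
  deriv (fun r : ℝ ↦ deriv (fun t : ℝ ↦ H ⟨μ.proj, μ.2 + r • α + t • β⟩) 0) 0

variable (EM F E) in
/-- A hyperregular Hamiltonian on `E*`: a smooth function `H` whose fibre derivative
`Φ : E* → E`, in coordinates `y^α = ∂H/∂μ_α`, is a global diffeomorphism. -/
structure HyperregularHamiltonian where
  /-- the Hamiltonian -/
  H : DualTotal F E → ℝ
  contMDiff_H : ContMDiff (𝓘(ℝ, EM).prod 𝓘(ℝ, F →L[ℝ] ℝ)) 𝓘(ℝ, ℝ) ∞ H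
  /-- the derivative of `H` along the fibre of `E*` at `μ`, as a vector in the fibre of `E` -/
  fiberDeriv : ∀ μ : DualTotal F E, E μ.proj
  hasDerivAt : ∀ (μ : DualTotal F E) (α : E μ.proj →L[ℝ] ℝ),
    HasDerivAt (fun t : ℝ ↦ H ⟨μ.proj, μ.2 + t • α⟩) (α (fiberDeriv μ)) 0
  /-- the fibre derivative as a diffeomorphism -/
  legendre : Diffeomorph (𝓘(ℝ, EM).prod 𝓘(ℝ, F →L[ℝ] ℝ)) (𝓘(ℝ, EM).prod 𝓘(ℝ, F))
    (DualTotal F E) (TotalSpace F E) ∞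
  legendre_apply : ∀ μ, legendre μ = ⟨μ.proj, fiberDeriv μ⟩

namespace HyperregularHamiltonian

variable (A : LieAlgebroid EM F E) (h : HyperregularHamiltonian EM F E)

/-- The induced diffeomorphism `Φ : E* → E`. -/
def Φ (μ : DualTotal F E) : TotalSpace F E := ⟨μ.proj, h.fiberDeriv μ⟩

theorem Φ_eq_legendre : h.Φ = h.legendre := funext fun μ ↦ (h.legendre_apply μ).symm

theorem Φ_legendre_symm (w : TotalSpace F E) : h.Φ (h.legendre.symm w) = w := by
  rw [Φ_eq_legendre, Diffeomorph.apply_symm_apply]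

/-- The prolonged tangent map `Φ_* : 𝒯E* → 𝒯E`, `Φ_*(u, v) = (u, TΦ(v))`. -/
def pushforward (μ : DualTotal F E) (a : A.TEdual μ) : A.TE (h.Φ μ) :=
  ⟨(a.1.1, mfderiv (𝓘(ℝ, EM).prod 𝓘(ℝ, F →L[ℝ] ℝ)) (𝓘(ℝ, EM).prod 𝓘(ℝ, F)) h.Φ μ a.1.2), by
    have ha : A.anchor μ.proj a.1.1 =
        mfderiv (𝓘(ℝ, EM).prod 𝓘(ℝ, F →L[ℝ] ℝ)) 𝓘(ℝ, EM)
          (TotalSpace.proj : DualTotal F E → M) μ a.1.2 := a.2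
    have hp : MDifferentiableAt (𝓘(ℝ, EM).prod 𝓘(ℝ, F)) 𝓘(ℝ, EM)
        (TotalSpace.proj : TotalSpace F E → M) (h.Φ μ) :=
      (contMDiff_proj (n := 1) E).mdifferentiable one_ne_zero _
    have hΦ : MDifferentiableAt (𝓘(ℝ, EM).prod 𝓘(ℝ, F →L[ℝ] ℝ)) (𝓘(ℝ, EM).prod 𝓘(ℝ, F))
        h.Φ μ := by
      rw [Φ_eq_legendre]
      exact h.legendre.contMDiff.mdifferentiable (by simp) μ
    have key := mfderiv_comp μ hp hΦ
    have hc : (TotalSpace.proj : TotalSpace F E → M) ∘ h.Φ = TotalSpace.proj := rfl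
    rw [hc] at key
    change A.anchor μ.proj a.1.1 = _
    rw [ha, key]
    rfl⟩

/-- The pushforward `Φ_* ρ = Φ_* ∘ ρ ∘ Φ⁻¹` of a section `ρ` of `𝒯E*`, a section of `𝒯E`. -/
def pushSection (ρ : ∀ μ, A.TEdual μ) (w : TotalSpace F E) : A.TE w :=
  h.Φ_legendre_symm w ▸ h.pushforward A (h.legendre.symm w) (ρ (h.legendre.symm w))

theorem pushSection_apply (ρ : ∀ μ, A.TEdual μ) (μ : DualTotal F E) :
    h.pushSection A ρ (h.Φ μ) = h.pushforward A μ (ρ μ) := by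
  have aux : ∀ ν (e : ν = μ) (e' : h.Φ ν = h.Φ μ),
      (e' ▸ h.pushforward A ν (ρ ν) : A.TE (h.Φ μ)) = h.pushforward A μ (ρ μ) := by
    rintro _ rfl _
    rfl
  exact aux _ (by rw [Φ_eq_legendre, Diffeomorph.symm_apply_apply]) _

/-- `K` is the almost tangent structure induced by the Hamiltonian: the symmetric adapted almost
tangent structure with `g(K ρ, K ν) = -ω(K ρ, ν)`, where `g` is the metric on the vertical bundle
of `𝒯E*` given by `g((0, α^v), (0, β^v)) = ∂²H/∂μ² (α, β)`. -/
structure IsInducedStructure (K : ∀ μ, A.TEdual μ →ₗ[ℝ] A.TEdual μ) : Prop where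
  adapted : A.IsAdapted K
  symm : ∀ ρ ν : ∀ μ, A.TEdual μ, A.IsSmooth ρ → A.IsSmooth ν → ∀ μ,
    A.omega (fun z ↦ K z (ρ z)) ν μ = A.omega (fun z ↦ K z (ν z)) ρ μ
  metric : ∀ ρ ν : ∀ μ, A.TEdual μ, A.IsSmooth ρ → A.IsSmooth ν →
    ∀ (μ : DualTotal F E) (α β : E μ.proj →L[ℝ] ℝ),
      K μ (ρ μ) = A.vertDual μ α → K μ (ν μ) = A.vertDual μ β →
        fiberHessian h.H μ α β = -A.omega (fun z ↦ K z (ρ z)) ν μ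

/-- A section of `𝒯E*` induced by the Hamiltonian: a smooth section
`(∂H/∂μ_α) 𝒬_α + ρ_α 𝒫^α` with arbitrary vertical components `ρ_α`. -/
structure IsInducedSection (ρ : ∀ μ, A.TEdual μ) : Prop where
  smooth : A.IsSmooth ρ
  fst_eq : ∀ μ, (ρ μ).1.1 = h.fiberDeriv μ

end HyperregularHamiltonian

end Main

end

/-! Everything rests on the identity $\Phi_*\circ\mathcal J=J\circ\Phi_*$. A vertical section
$\alpha^v$ satisfies $\omega_E(\alpha^v,\nu)=-\alpha(\nu_E)$, where $\nu_E$ is the $E$-component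
(`omega_vertDual`), and the fibre Hessian of $\mathcal H$ is the derivative of $\Phi$ along the
fibre (`fiberHessian_eq`). Symmetry and metric compatibility of $\mathcal J$ therefore say that
$\mathcal J(u,v)=\beta^v$ with $u=D_\beta\Phi$, the fibre derivative of $\Phi$ along $\beta$
(`fst_eq_vertDeriv`). Since $T\Phi(\beta^v)=(D_\beta\Phi)^v$, this is the stated identity
(`pushforward_apply`).

Regularity: for vertical $\mathcal J\nu=\beta^v$, the $E$-component of $[\rho,\mathcal J\nu]$ is
minus the derivative of $\rho_E=\Phi$ along $\beta^v$, that is $-D_\beta\Phi=-\nu_E$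
(`prolBracket_fst`). As $\mathcal J$ sees only $E$-components, $\mathcal J[\rho,\mathcal
J\nu]=-\mathcal J\nu$. The freedom in the vertical part of $\rho$ plays no role.

Connection: the same computation shows that $\mathcal N=-\mathcal L_\rho\mathcal J$ preserves
$E$-components. On a vertical $\mathcal J\eta$ it is $-1$, because $\mathcal J^2=0$ and $\rho$ is
regular. Hence $\mathcal Na-a$ is vertical, $\mathcal N(\mathcal Na-a)=a-\mathcal Na$, and $\mathcal
N^2=\mathrm{Id}$. That $\mathcal N$ is a pointwise linear map at all is tensoriality of the Lie
derivative (`exists_lieDerivative_snd`).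

Transfer: $\Phi_*$ is a fibrewise isomorphism which intertwines the brackets
(`prolBracket_pushSection`) and the endomorphisms $\mathcal J$ and $J$, so it carries $\mathcal
L_\rho\mathcal J$ to $\mathcal L_{\Phi_*\rho}J$ and one connection to the other.

The remaining work makes the bracket of the prolongation usable: it must take values in the
prolongation and be smooth. This is checked in preferred trivializations and charts, through a local
formula for the algebroid bracket (`bracketAt_eq`) and its compatibility with the anchor
(`anchor_structureMap`). -/

set_option linter.unusedSectionVars false

noncomputable section

section

/-! ### Directional derivatives and Lie brackets in charts -/

section DirDerivCalculus

variable {EP : Type*} [NormedAddCommGroup EP] [NormedSpace ℝ EP]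
  {HP : Type*} [TopologicalSpace HP] {IP : ModelWithCorners ℝ EP HP}
  {P : Type*} [TopologicalSpace P] [ChartedSpace HP P]
  {EQ : Type*} [NormedAddCommGroup EQ] [NormedSpace ℝ EQ]
  {HQ : Type*} [TopologicalSpace HQ] {IQ : ModelWithCorners ℝ EQ HQ}
  {Q : Type*} [TopologicalSpace Q] [ChartedSpace HQ Q]
  {W : Type*} [NormedAddCommGroup W] [NormedSpace ℝ W]
  {W' : Type*} [NormedAddCommGroup W'] [NormedSpace ℝ W']

theorem dirDeriv_congr {f g : P → W} {w : P} (h : f =ᶠ[𝓝 w] g) (v : TangentSpace IP w) :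
    dirDeriv IP f w v = dirDeriv IP g w v := by
  unfold dirDeriv
  rw [h.mfderiv_eq]
  rfl

theorem dirDeriv_const (c : W) (w : P) (v : TangentSpace IP w) :
    dirDeriv IP (fun _ : P ↦ c) w v = 0 := by
  unfold dirDeriv
  rw [mfderiv_const]
  rfl

theorem dirDeriv_vec_add (f : P → W) (w : P) (v v' : TangentSpace IP w) :
    dirDeriv IP f w (v + v') = dirDeriv IP f w v + dirDeriv IP f w v' :=
  map_add (mfderiv IP 𝓘(ℝ, W) f w) v v'

theorem dirDeriv_vec_smul (f : P → W) (w : P) (c : ℝ) (v : TangentSpace IP w) :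
    dirDeriv IP f w (c • v) = c • dirDeriv IP f w v :=
  map_smul (mfderiv IP 𝓘(ℝ, W) f w) c v

theorem dirDeriv_vec_zero (f : P → W) (w : P) :
    dirDeriv IP f w (0 : TangentSpace IP w) = 0 :=
  map_zero (mfderiv IP 𝓘(ℝ, W) f w)

/-- The directional derivative along a composition, `v (f ∘ p) = (T p v) f`. -/
theorem dirDeriv_comp {f : Q → W} {p : P → Q} {w : P}
    (hf : MDifferentiableAt IQ 𝓘(ℝ, W) f (p w)) (hp : MDifferentiableAt IP IQ p w)
    (v : TangentSpace IP w) :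
    dirDeriv IP (fun z ↦ f (p z)) w v = dirDeriv IQ f (p w) (mfderiv IP IQ p w v) := by
  unfold dirDeriv
  exact DFunLike.congr_fun (mfderiv_comp w hf hp) v

theorem dirDeriv_of_hasFDerivAt {φ : W → W'} {f : P → W} {w : P} {φ' : W →L[ℝ] W'}
    (hφ : HasFDerivAt φ φ' (f w)) (hf : MDifferentiableAt IP 𝓘(ℝ, W) f w)
    (v : TangentSpace IP w) :
    dirDeriv IP (fun z ↦ φ (f z)) w v = φ' (dirDeriv IP f w v) := by
  unfold dirDeriv
  exact DFunLike.congr_fun (HasMFDerivAt.comp w hφ.hasMFDerivAt hf.hasMFDerivAt).mfderiv v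

theorem dirDeriv_clm (L : W →L[ℝ] W') {f : P → W} {w : P}
    (hf : MDifferentiableAt IP 𝓘(ℝ, W) f w) (v : TangentSpace IP w) :
    dirDeriv IP (fun z ↦ L (f z)) w v = L (dirDeriv IP f w v) :=
  dirDeriv_of_hasFDerivAt L.hasFDerivAt hf v

/-- The product rule for a continuous bilinear map. -/
theorem dirDeriv_bilin {W₁ W₂ : Type*} [NormedAddCommGroup W₁] [NormedSpace ℝ W₁]
    [NormedAddCommGroup W₂] [NormedSpace ℝ W₂] (B : W₁ →L[ℝ] W₂ →L[ℝ] W) {f : P → W₁} {g : P → W₂}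
    {w : P} (hf : MDifferentiableAt IP 𝓘(ℝ, W₁) f w) (hg : MDifferentiableAt IP 𝓘(ℝ, W₂) g w)
    (v : TangentSpace IP w) :
    dirDeriv IP (fun z ↦ B (f z) (g z)) w v =
      B (dirDeriv IP f w v) (g w) + B (f w) (dirDeriv IP g w v) := by
  have hc : ContinuousAt (fun z ↦ B (f z) (g z)) w :=
    (B.continuous.continuousAt.comp hf.continuousAt).clm_apply hg.continuousAt
  have h : HasMFDerivAt IP 𝓘(ℝ, W) (fun z ↦ B (f z) (g z)) w _ :=
    ⟨hc, B.hasFDerivWithinAt_of_bilinear hf.hasMFDerivAt.2 hg.hasMFDerivAt.2⟩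
  have h' := DFunLike.congr_fun h.mfderiv v
  unfold dirDeriv
  refine h'.trans ((add_comm _ _).trans ?_)
  simp only [extChartAt_to_inv]
  rfl

/-- The product rule for the evaluation pairing. -/
theorem dirDeriv_clm_apply {L : P → W →L[ℝ] W'} {f : P → W} {w : P}
    (hL : MDifferentiableAt IP 𝓘(ℝ, W →L[ℝ] W') L w)
    (hf : MDifferentiableAt IP 𝓘(ℝ, W) f w) (v : TangentSpace IP w) :
    dirDeriv IP (fun z ↦ L z (f z)) w v =
      dirDeriv IP L w v (f w) + L w (dirDeriv IP f w v) :=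
  dirDeriv_bilin (ContinuousLinearMap.id ℝ (W →L[ℝ] W')) hL hf v

section Chart

variable [IsManifold IP ∞ P]

/-- The tangent space at `w` is by definition the model space, identified through the preferred
chart at `w`. Later coordinate computations at the base point read tangent vectors as elements of
the model space in this way. -/
theorem dirDeriv_extChartAt_self (w : P) (v : TangentSpace IP w) :
    dirDeriv IP (extChartAt IP w) w v = v := by
  have : IsManifold IP 1 P := .of_le (n := ∞) (by simp)
  unfold dirDeriv
  rw [mfderiv_extChartAt_self]
  rfl

theorem dirDeriv_extChartAt_eq_trivializationAt {w z : P} (hz : z ∈ (chartAt HP w).source)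
    (v : TangentSpace IP z) :
    dirDeriv IP (extChartAt IP w) z v =
      (trivializationAt EP (TangentSpace IP : P → Type _) w ⟨z, v⟩).2 := by
  have : IsManifold IP 1 P := .of_le (n := ∞) (by simp)
  have h := TangentBundle.continuousLinearMapAt_trivializationAt (I := IP) hz
  have h' := DFunLike.congr_fun h v
  have h2 := congrFun (Trivialization.coe_linearMapAt_of_mem (R := ℝ)
    (trivializationAt EP (TangentSpace IP : P → Type _) w) (b := z) (by simpa using hz)) v
  exact h'.symm.trans h2

theorem ContMDiffAt.dirDeriv_extChartAt {U : ∀ z : P, TangentSpace IP z} {w : P}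
    (hU : ContMDiffAt IP IP.tangent ∞ (fun z ↦ (⟨z, U z⟩ : TangentBundle IP P)) w) :
    ContMDiffAt IP 𝓘(ℝ, EP) ∞ (fun z ↦ dirDeriv IP (extChartAt IP w) z (U z)) w := by
  have h := ((contMDiffAt_section (IB := IP) (F := EP) w).1 hU)
  refine h.congr_of_eventuallyEq ?_
  filter_upwards [chart_source_mem_nhds HP w] with z hz
  exact dirDeriv_extChartAt_eq_trivializationAt hz _

theorem contMDiffAt_tangentBundle_of_dirDeriv_extChartAt {U : ∀ z : P, TangentSpace IP z}
    {w : P} (hU : ContMDiffAt IP 𝓘(ℝ, EP) ∞ (fun z ↦ dirDeriv IP (extChartAt IP w) z (U z)) w) :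
    ContMDiffAt IP IP.tangent ∞ (fun z ↦ (⟨z, U z⟩ : TangentBundle IP P)) w := by
  refine ((contMDiffAt_section (IB := IP) (F := EP) w).2 ?_)
  refine hU.congr_of_eventuallyEq ?_
  filter_upwards [chart_source_mem_nhds HP w] with z hz
  exact (dirDeriv_extChartAt_eq_trivializationAt hz _).symm

theorem dirDeriv_eq_fderiv [IP.Boundaryless] {f : P → W} {w : P}
    (hf : MDifferentiableAt IP 𝓘(ℝ, W) f w) (v : TangentSpace IP w) :
    dirDeriv IP f w v = fderiv ℝ (f ∘ (extChartAt IP w).symm) (extChartAt IP w w) v := by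
  unfold dirDeriv
  rw [hf.mfderiv, IP.range_eq_univ, fderivWithin_univ]
  rfl

/-- In the chart at `w`, the Lie bracket of vector fields is the commutator of the directional
derivatives of the coordinate representations. -/
theorem mlieBracket_eq_dirDeriv_sub [IP.Boundaryless] [CompleteSpace EP]
    {U V : ∀ z : P, TangentSpace IP z} {w : P}
    (hU : ContMDiffAt IP IP.tangent ∞ (fun z ↦ (⟨z, U z⟩ : TangentBundle IP P)) w)
    (hV : ContMDiffAt IP IP.tangent ∞ (fun z ↦ (⟨z, V z⟩ : TangentBundle IP P)) w) :
    mlieBracket IP U V w =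
      (dirDeriv IP (fun z ↦ dirDeriv IP (extChartAt IP w) z (V z)) w (U w) -
        dirDeriv IP (fun z ↦ dirDeriv IP (extChartAt IP w) z (U z)) w (V w) : EP) := by
  have : IsManifold IP 1 P := .of_le (n := ∞) (by simp)
  -- The inverse of the differential of the inverse chart is the differential of the chart, so the
  -- pulled-back field is the coordinate representation of `X`.
  have key : ∀ X : ∀ z : P, TangentSpace IP z,
      mpullbackWithin 𝓘(ℝ, EP) IP (extChartAt IP w).symm X (Set.range IP)
      =ᶠ[𝓝 (extChartAt IP w w)]
      (fun z ↦ dirDeriv IP (extChartAt IP w) z (X z)) ∘ (extChartAt IP w).symm := by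
    intro X
    filter_upwards [extChartAt_target_mem_nhds (I := IP) w] with y hy
    rw [mpullbackWithin_apply]
    have h1 := mfderiv_extChartAt_comp_mfderivWithin_extChartAt_symm (I := IP) hy
    have h2 := mfderivWithin_extChartAt_symm_comp_mfderiv_extChartAt (I := IP) hy
    rw [ContinuousLinearMap.inverse_eq h2 h1]
    rfl
  have hb : ∀ (X Y X' Y' : EP → EP) (s : Set EP) (x : EP), s = Set.univ → X =ᶠ[𝓝 x] X' →
      Y =ᶠ[𝓝 x] Y' →
      lieBracketWithin ℝ X Y s x = fderiv ℝ Y' x (X' x) - fderiv ℝ X' x (Y' x) := by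
    rintro X Y X' Y' _ x rfl hX hY
    rw [lieBracketWithin_univ, ← hX.fderiv_eq, ← hY.fderiv_eq, ← hX.eq_of_nhds,
      ← hY.eq_of_nhds]
    rfl
  rw [dirDeriv_eq_fderiv (hV.dirDeriv_extChartAt.mdifferentiableAt (by simp)),
    dirDeriv_eq_fderiv (hU.dirDeriv_extChartAt.mdifferentiableAt (by simp))]
  unfold mlieBracket
  rw [mlieBracketWithin_apply, mfderiv_extChartAt_self]
  have hi : ∀ x, (ContinuousLinearMap.id ℝ (TangentSpace IP w)).inverse x = x := fun x ↦ by
    rw [ContinuousLinearMap.inverse_id]; rfl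
  refine (hi _).trans ((hb _ _ _ _ _ _ ?_ (key U) (key V)).trans ?_)
  · simp [IP.range_eq_univ]
  · have hs : ∀ (X : ∀ z : P, TangentSpace IP z) (z : P), z = w →
        dirDeriv IP (extChartAt IP w) z (X z) = X w := by
      rintro X _ rfl
      exact dirDeriv_extChartAt_self _ _
    exact congrArg₂ (fun a b : EP ↦ fderiv ℝ _ _ a - fderiv ℝ _ _ b)
      (hs U _ (extChartAt_to_inv w)) (hs V _ (extChartAt_to_inv w))

/-- A family of continuous linear maps depends smoothly on the parameter if it does so
pointwise. -/
theorem contMDiffAt_clm_of_apply {L : P → W →L[ℝ] W'} [FiniteDimensional ℝ W] {w : P}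
    (h : ∀ c, ContMDiffAt IP 𝓘(ℝ, W') ∞ (fun z ↦ L z c) w) :
    ContMDiffAt IP 𝓘(ℝ, W →L[ℝ] W') ∞ L w := by
  let b := Module.finBasis ℝ W
  have hL : L = fun z ↦ ∑ i, (ContinuousLinearMap.smulRightL ℝ W W'
      (LinearMap.toContinuousLinearMap (b.coord i))) (L z (b i)) := by
    funext z
    ext c
    calc L z c = L z (∑ i, b.repr c i • b i) := by rw [b.sum_repr]
      _ = _ := by simp only [map_sum, map_smul]; simp
  rw [hL]
  refine contMDiffAt_finsetSum (fun i _ ↦ ?_)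
  exact (ContinuousLinearMap.contMDiff _).contMDiffAt.comp w (h (b i))

end Chart

end DirDerivCalculus

end

section

/-! ### Coordinates in a fixed local trivialization -/

section FrameCoordinates

variable {EM : Type*} [NormedAddCommGroup EM] [NormedSpace ℝ EM]
  {M : Type*} [TopologicalSpace M] [ChartedSpace EM M] [IsManifold 𝓘(ℝ, EM) ∞ M]
  {F : Type*} [NormedAddCommGroup F] [NormedSpace ℝ F]
  {E : M → Type*} [TopologicalSpace (TotalSpace F E)]
  [∀ x, AddCommGroup (E x)] [∀ x, Module ℝ (E x)] [∀ x, TopologicalSpace (E x)]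
  [FiberBundle F E] [VectorBundle ℝ F E]
  {EP : Type*} [NormedAddCommGroup EP] [NormedSpace ℝ EP]
  {HP : Type*} [TopologicalSpace HP] {IP : ModelWithCorners ℝ EP HP}
  {P : Type*} [TopologicalSpace P] [ChartedSpace HP P]

variable (F) in
/-- The coordinates of a vector of `E` in the preferred trivialization at `x₀`. -/
def coordAt (x₀ : M) {x : M} (u : E x) : F := (trivializationAt F E x₀ ⟨x, u⟩).2

variable (F E) in
/-- The vector of `E x` with given coordinates in the preferred trivialization at `x₀`. -/
def ofCoord (x₀ x : M) (c : F) : E x := (trivializationAt F E x₀).symm x c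

section Linear

variable {x₀ x : M} (hx : x ∈ (trivializationAt F E x₀).baseSet)
include hx

theorem coordAt_add (u v : E x) : coordAt F x₀ (u + v) = coordAt F x₀ u + coordAt F x₀ v :=
  ((trivializationAt F E x₀).linear ℝ hx).map_add u v

theorem coordAt_smul (c : ℝ) (u : E x) : coordAt F x₀ (c • u) = c • coordAt F x₀ u :=
  ((trivializationAt F E x₀).linear ℝ hx).map_smul c u

theorem coordAt_zero : coordAt F x₀ (0 : E x) = 0 :=
  (((trivializationAt F E x₀).linear ℝ hx).mk' _).map_zero

theorem coordAt_neg (u : E x) : coordAt F x₀ (-u) = -coordAt F x₀ u :=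
  (((trivializationAt F E x₀).linear ℝ hx).mk' _).map_neg u

theorem coordAt_sum {ι : Type*} (s : Finset ι) (u : ι → E x) :
    coordAt F x₀ (∑ i ∈ s, u i) = ∑ i ∈ s, coordAt F x₀ (u i) :=
  map_sum (((trivializationAt F E x₀).linear ℝ hx).mk' _) u s

theorem coordAt_ofCoord (c : F) : coordAt F x₀ (ofCoord F E x₀ x c) = c := by
  simp [coordAt, ofCoord, hx]

theorem ofCoord_coordAt (u : E x) : ofCoord F E x₀ x (coordAt F x₀ u) = u := by
  simp [coordAt, ofCoord, hx]

theorem coordAt_injective {u v : E x} (h : coordAt F x₀ u = coordAt F x₀ v) : u = v := by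
  rw [← ofCoord_coordAt hx u, h, ofCoord_coordAt hx]

theorem ofCoord_add (c d : F) :
    ofCoord F E x₀ x (c + d) = ofCoord F E x₀ x c + ofCoord F E x₀ x d := by
  apply coordAt_injective hx
  simp only [coordAt_add hx, coordAt_ofCoord hx]

theorem ofCoord_smul (r : ℝ) (c : F) :
    ofCoord F E x₀ x (r • c) = r • ofCoord F E x₀ x c := by
  apply coordAt_injective hx
  simp only [coordAt_smul hx, coordAt_ofCoord hx]

end Linear

theorem mem_baseSet_self (x : M) : x ∈ (trivializationAt F E x).baseSet :=
  mem_baseSet_trivializationAt F E x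

theorem eventually_mem_baseSet (x : M) : ∀ᶠ y in 𝓝 x, y ∈ (trivializationAt F E x).baseSet :=
  (trivializationAt F E x).open_baseSet.mem_nhds (mem_baseSet_self x)

variable [ContMDiffVectorBundle ∞ F E 𝓘(ℝ, EM)]

theorem contMDiffAt_coordAt {x₀ : M} {p : P → M} {u : ∀ z, E (p z)} {w : P}
    (hw : p w ∈ (trivializationAt F E x₀).baseSet)
    (hu : ContMDiffAt IP (𝓘(ℝ, EM).prod 𝓘(ℝ, F)) ∞ (fun z ↦ (⟨p z, u z⟩ : TotalSpace F E)) w) :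
    ContMDiffAt IP 𝓘(ℝ, F) ∞ (fun z ↦ coordAt F x₀ (u z)) w :=
  (((trivializationAt F E x₀).contMDiffAt_iff
    ((trivializationAt F E x₀).mem_source.2 hw)).1 hu).2

theorem contMDiffAt_of_coordAt {x₀ : M} {p : P → M} {u : ∀ z, E (p z)} {w : P}
    (hw : p w ∈ (trivializationAt F E x₀).baseSet) (hp : ContMDiffAt IP 𝓘(ℝ, EM) ∞ p w)
    (hu : ContMDiffAt IP 𝓘(ℝ, F) ∞ (fun z ↦ coordAt F x₀ (u z)) w) :
    ContMDiffAt IP (𝓘(ℝ, EM).prod 𝓘(ℝ, F)) ∞ (fun z ↦ (⟨p z, u z⟩ : TotalSpace F E)) w :=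
  ((trivializationAt F E x₀).contMDiffAt_iff
    ((trivializationAt F E x₀).mem_source.2 hw)).2 ⟨hp, hu⟩

/-- Sections with constant coordinates are smooth. -/
theorem contMDiffAt_ofCoord {x₀ x : M} (hx : x ∈ (trivializationAt F E x₀).baseSet) (c : F) :
    ContMDiffAt 𝓘(ℝ, EM) (𝓘(ℝ, EM).prod 𝓘(ℝ, F)) ∞
      (fun y ↦ (⟨y, ofCoord F E x₀ y c⟩ : TotalSpace F E)) x := by
  refine contMDiffAt_of_coordAt (p := fun y : M ↦ y) hx contMDiffAt_id ?_
  refine (contMDiffAt_const (c := c)).congr_of_eventuallyEq ?_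
  filter_upwards [(trivializationAt F E x₀).open_baseSet.mem_nhds hx] with y hy
  exact coordAt_ofCoord hy c

end FrameCoordinates

/-! ### Cutoff functions -/

section Bump

variable {EM : Type*} [NormedAddCommGroup EM] [NormedSpace ℝ EM] [FiniteDimensional ℝ EM]
  {M : Type*} [TopologicalSpace M] [ChartedSpace EM M] [IsManifold 𝓘(ℝ, EM) ∞ M] [T2Space M]
  {W : Type*} [NormedAddCommGroup W] [NormedSpace ℝ W]

theorem exists_contMDiff_cutoff {x : M} {U : Set M} (hU : U ∈ 𝓝 x) :
    ∃ f : M → ℝ, ContMDiff 𝓘(ℝ, EM) 𝓘(ℝ, ℝ) ∞ f ∧ tsupport f ⊆ U ∧ f =ᶠ[𝓝 x] 1 := by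
  obtain ⟨f, -, hf⟩ := (SmoothBumpFunction.nhds_basis_tsupport (I := 𝓘(ℝ, EM)) x).mem_iff.1 hU
  exact ⟨f, f.contMDiff, hf, f.eventuallyEq_one⟩

theorem exists_contMDiff_eventuallyEq {x : M} {U : Set M} (hU : IsOpen U) (hx : x ∈ U)
    {g : M → W} (hg : ContMDiffOn 𝓘(ℝ, EM) 𝓘(ℝ, W) ∞ g U) :
    ∃ f : M → W, ContMDiff 𝓘(ℝ, EM) 𝓘(ℝ, W) ∞ f ∧ f =ᶠ[𝓝 x] g := by
  obtain ⟨f, hf, hfU, hf1⟩ := exists_contMDiff_cutoff (EM := EM) (hU.mem_nhds hx)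
  refine ⟨fun y ↦ f y • g y, fun y ↦ ?_, ?_⟩
  · by_cases hy : y ∈ tsupport f
    · exact hf.contMDiffAt.smul (hg.contMDiffAt (hU.mem_nhds (hfU hy)))
    · refine (contMDiffAt_const (c := (0 : W))).congr_of_eventuallyEq ?_
      filter_upwards [(isClosed_tsupport f).isOpen_compl.mem_nhds hy] with z hz
      rw [image_eq_zero_of_notMem_tsupport hz, zero_smul]
  · filter_upwards [hf1] with y hy
    rw [hy, Pi.one_apply, one_smul]

end Bump

/-! ### Locality and coordinate formula of the algebroid bracket -/

namespace LieAlgebroid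

variable {EM : Type*} [NormedAddCommGroup EM] [NormedSpace ℝ EM]
  {M : Type*} [TopologicalSpace M] [ChartedSpace EM M] [IsManifold 𝓘(ℝ, EM) ∞ M]
  {F : Type*} [NormedAddCommGroup F] [NormedSpace ℝ F]
  {E : M → Type*} [TopologicalSpace (TotalSpace F E)]
  [∀ x, AddCommGroup (E x)] [∀ x, Module ℝ (E x)] [∀ x, TopologicalSpace (E x)]
  [FiberBundle F E] [VectorBundle ℝ F E] (A : LieAlgebroid EM F E)

theorem bracket_add_left (r s t : Cₛ^∞⟮𝓘(ℝ, EM); F, E⟯) :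
    A.bracket (r + s) t = A.bracket r t + A.bracket s t := by
  rw [A.bracket_skew, A.bracket_add, A.bracket_skew r, A.bracket_skew s]
  abel

theorem bracket_smul_left (c : ℝ) (s t : Cₛ^∞⟮𝓘(ℝ, EM); F, E⟯) :
    A.bracket (c • s) t = c • A.bracket s t := by
  rw [A.bracket_skew, A.bracket_smul, A.bracket_skew s, smul_neg]

/-- The value of the bracket at a point, as a bilinear map of sections. -/
def bracketAt (x : M) : Cₛ^∞⟮𝓘(ℝ, EM); F, E⟯ →ₗ[ℝ] Cₛ^∞⟮𝓘(ℝ, EM); F, E⟯ →ₗ[ℝ] E x :=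
  LinearMap.mk₂ ℝ (fun s t ↦ A.bracket s t x)
    (fun r s t ↦ by simp [A.bracket_add_left])
    (fun c s t ↦ by simp [A.bracket_smul_left])
    (fun r s t ↦ by simp [A.bracket_add])
    (fun c s t ↦ by simp [A.bracket_smul])

theorem bracketAt_apply (x : M) (s t : Cₛ^∞⟮𝓘(ℝ, EM); F, E⟯) :
    A.bracketAt x s t = A.bracket s t x := rfl

theorem bracketAt_skew (x : M) (s t : Cₛ^∞⟮𝓘(ℝ, EM); F, E⟯) :
    A.bracketAt x s t = -A.bracketAt x t s := by
  rw [bracketAt_apply, A.bracket_skew]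
  rfl

variable [FiniteDimensional ℝ EM] [T2Space M]

/-- Take a cutoff `f`, equal to 1 near `x` and supported where `t` vanishes. Then `f • t = 0`, and
in the Leibniz rule at `x` the derivative of `f` is multiplied by `t x = 0`, so only the bracket
itself remains. -/
theorem bracketAt_eq_zero_of_eventually {x : M} (s : Cₛ^∞⟮𝓘(ℝ, EM); F, E⟯)
    {t : Cₛ^∞⟮𝓘(ℝ, EM); F, E⟯} (ht : ∀ᶠ y in 𝓝 x, t y = 0) : A.bracketAt x s t = 0 := by
  obtain ⟨f, hf, hfU, hf1⟩ := exists_contMDiff_cutoff (EM := EM) ht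
  have h0 : (⟨f • ⇑t, hf.smul_section t.contMDiff⟩ : Cₛ^∞⟮𝓘(ℝ, EM); F, E⟯) = 0 := by
    ext y
    by_cases hy : y ∈ tsupport f
    · have : t y = 0 := hfU hy
      simp [this]
    · simp [image_eq_zero_of_notMem_tsupport hy]
  have h := A.leibniz s t f hf x
  rw [h0, hf1.eq_of_nhds, ht.self_of_nhds, smul_zero, add_zero, Pi.one_apply, one_smul] at h
  rw [bracketAt_apply, ← h, ← bracketAt_apply, map_zero]

/-- The bracket of sections is a local operator. -/
theorem bracketAt_congr {x : M} {s s' t t' : Cₛ^∞⟮𝓘(ℝ, EM); F, E⟯}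
    (hs : ∀ᶠ y in 𝓝 x, s y = s' y) (ht : ∀ᶠ y in 𝓝 x, t y = t' y) :
    A.bracketAt x s t = A.bracketAt x s' t' := by
  have h1 : A.bracketAt x s (t - t') = 0 := A.bracketAt_eq_zero_of_eventually s
    (ht.mono fun y hy ↦ by simp [hy])
  have h2 : A.bracketAt x t' (s - s') = 0 := A.bracketAt_eq_zero_of_eventually t'
    (hs.mono fun y hy ↦ by simp [hy])
  rw [map_sub, sub_eq_zero] at h1 h2
  rw [h1, A.bracketAt_skew, h2, ← A.bracketAt_skew]

variable [ContMDiffVectorBundle ∞ F E 𝓘(ℝ, EM)]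

theorem localConst_self {x : M} (u : E x) : localConst (EM := EM) (F := F) u x = u := by
  rw [(localConst_eventuallyEq (EM := EM) (F := F) u).self_of_nhds]
  exact FiberBundle.extend_apply_self F u

theorem localConst_eventuallyEq_ofCoord {x : M} (u : E x) :
    ∀ᶠ y in 𝓝 x, localConst (EM := EM) (F := F) u y = ofCoord F E x y (coordAt F x u) :=
  localConst_eventuallyEq u

/-- The bracket, at `x`, of the sections through `u, v ∈ E x` which are constant in the preferred
trivialization at `x`. -/
def structureMap (x : M) : E x →ₗ[ℝ] E x →ₗ[ℝ] E x :=
  LinearMap.mk₂ ℝ (fun u v ↦ A.bracketAt x (localConst u) (localConst v))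
    (fun u u' v ↦ by
      rw [← LinearMap.add_apply, ← map_add]
      -- The sections `localConst` are arbitrary choices away from the base point, so they are
      -- additive and homogeneous only as germs. Locality of the bracket makes that sufficient.
      refine A.bracketAt_congr ?_ (.of_forall fun _ ↦ rfl)
      filter_upwards [localConst_eventuallyEq_ofCoord (EM := EM) (F := F) u,
        localConst_eventuallyEq_ofCoord (EM := EM) (F := F) u',
        localConst_eventuallyEq_ofCoord (EM := EM) (F := F) (u + u'),
        eventually_mem_baseSet (F := F) (E := E) x] with y h1 h2 h3 hy
      rw [ContMDiffSection.coe_add, Pi.add_apply, h1, h2, h3, coordAt_add (mem_baseSet_self x),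
        ofCoord_add hy])
    (fun c u v ↦ by
      rw [← LinearMap.smul_apply, ← map_smul]
      refine A.bracketAt_congr ?_ (.of_forall fun _ ↦ rfl)
      filter_upwards [localConst_eventuallyEq_ofCoord (EM := EM) (F := F) u,
        localConst_eventuallyEq_ofCoord (EM := EM) (F := F) (c • u),
        eventually_mem_baseSet (F := F) (E := E) x] with y h1 h3 hy
      rw [ContMDiffSection.coe_smul, Pi.smul_apply, h1, h3, coordAt_smul (mem_baseSet_self x),
        ofCoord_smul hy])
    (fun u v v' ↦ by
      rw [← map_add]
      refine A.bracketAt_congr (.of_forall fun _ ↦ rfl) ?_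
      filter_upwards [localConst_eventuallyEq_ofCoord (EM := EM) (F := F) v,
        localConst_eventuallyEq_ofCoord (EM := EM) (F := F) v',
        localConst_eventuallyEq_ofCoord (EM := EM) (F := F) (v + v'),
        eventually_mem_baseSet (F := F) (E := E) x] with y h1 h2 h3 hy
      rw [ContMDiffSection.coe_add, Pi.add_apply, h1, h2, h3, coordAt_add (mem_baseSet_self x),
        ofCoord_add hy])
    (fun c u v ↦ by
      rw [← map_smul]
      refine A.bracketAt_congr (.of_forall fun _ ↦ rfl) ?_
      filter_upwards [localConst_eventuallyEq_ofCoord (EM := EM) (F := F) v,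
        localConst_eventuallyEq_ofCoord (EM := EM) (F := F) (c • v),
        eventually_mem_baseSet (F := F) (E := E) x] with y h1 h3 hy
      rw [ContMDiffSection.coe_smul, Pi.smul_apply, h1, h3, coordAt_smul (mem_baseSet_self x),
        ofCoord_smul hy])

theorem structureMap_apply {x : M} (u v : E x) :
    A.structureMap x u v = A.bracket (localConst u) (localConst v) x := rfl

variable [FiniteDimensional ℝ F]

theorem contMDiffOn_coordAt_section (t : Cₛ^∞⟮𝓘(ℝ, EM); F, E⟯) (x : M) :
    ContMDiffOn 𝓘(ℝ, EM) 𝓘(ℝ, F) ∞ (fun y ↦ coordAt F x (t y))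
      (trivializationAt F E x).baseSet :=
  fun _ hy ↦ (contMDiffAt_coordAt (p := fun y : M ↦ y) hy
    t.contMDiff.contMDiffAt).contMDiffWithinAt

/-- Near `x`, `t` is a combination of a frame of constant-coordinate sections, with the coordinates
of `t` as coefficients. The Leibniz rule splits off the derivatives of the coefficients, and what is
left is the bracket with the combination whose coefficients are frozen at `x`. -/
theorem bracketAt_eq_add_localConst_right (s t : Cₛ^∞⟮𝓘(ℝ, EM); F, E⟯) (x : M) :
    A.bracketAt x s t =
      ofCoord F E x x (dirDeriv 𝓘(ℝ, EM) (fun y ↦ coordAt F x (t y)) x (A.anchor x (s x))) +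
        A.bracketAt x s (localConst (t x)) := by
  let b := Module.finBasis ℝ F
  have hx := mem_baseSet_self (F := F) (E := E) x
  let s' : Fin (Module.finrank ℝ F) → Cₛ^∞⟮𝓘(ℝ, EM); F, E⟯ :=
    fun i ↦ localConst (ofCoord F E x x (b i))
  -- The Leibniz rule needs globally smooth coefficients, while the coordinates of `t` are smooth
  -- only on the trivializing set; `g` is a global function with the same germ at `x`.
  obtain ⟨g, hg, hgt⟩ := exists_contMDiff_eventuallyEq (trivializationAt F E x).open_baseSet hx
    (contMDiffOn_coordAt_section t x)
  let φ : Fin (Module.finrank ℝ F) → F →L[ℝ] ℝ := fun i ↦ LinearMap.toContinuousLinearMap (b.coord i)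
  have hφ : ∀ c, ∑ i, φ i c • b i = c := fun c ↦ b.sum_repr c
  have hf : ∀ i, ContMDiff 𝓘(ℝ, EM) 𝓘(ℝ, ℝ) ∞ (fun y ↦ φ i (g y)) := fun i ↦
    (φ i).contMDiff.comp hg
  let T : Fin (Module.finrank ℝ F) → Cₛ^∞⟮𝓘(ℝ, EM); F, E⟯ := fun i ↦
    ⟨(fun y ↦ φ i (g y)) • ⇑(s' i), (hf i).smul_section (s' i).contMDiff⟩
  have hs' : ∀ᶠ y in 𝓝 x, ∀ i, s' i y = ofCoord F E x y (b i) := by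
    refine eventually_all.2 fun i ↦ ?_
    filter_upwards [localConst_eventuallyEq_ofCoord (EM := EM) (F := F) (ofCoord F E x x (b i))]
      with y hy
    rw [hy, coordAt_ofCoord hx]
  have hsum : ∀ (T : Fin (Module.finrank ℝ F) → Cₛ^∞⟮𝓘(ℝ, EM); F, E⟯) (y : M),
      (∑ i, T i) y = ∑ i, T i y := fun T y ↦ by
    have := congrFun (map_sum (ContMDiffSection.coeAddHom 𝓘(ℝ, EM) F ∞ E) T Finset.univ) y
    rw [Finset.sum_apply] at this
    exact this
  have hcoord : ∀ (y : M) (hy : y ∈ (trivializationAt F E x).baseSet) (c : F),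
      ofCoord F E x y c = ∑ i, φ i c • ofCoord F E x y (b i) := fun y hy c ↦ by
    apply coordAt_injective hy
    simp only [coordAt_ofCoord hy, coordAt_sum hy, coordAt_smul hy, hφ]
  have hT : ∀ᶠ y in 𝓝 x, t y = (∑ i, T i) y := by
    filter_upwards [hs', hgt, eventually_mem_baseSet (F := F) (E := E) x] with y h1 h2 hy
    rw [hsum]
    simp only [T, ContMDiffSection.coeFn_mk, Pi.smul_apply', h1, h2]
    rw [← hcoord y hy, ofCoord_coordAt hy]
  have hc : ∀ᶠ y in 𝓝 x, localConst (EM := EM) (F := F) (t x) y =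
      (∑ i, φ i (g x) • s' i) y := by
    filter_upwards [hs', eventually_mem_baseSet (F := F) (E := E) x,
      localConst_eventuallyEq_ofCoord (EM := EM) (F := F) (t x)] with y h1 hy h2
    rw [hsum, h2]
    simp only [ContMDiffSection.coe_smul, Pi.smul_apply, h1]
    rw [hcoord y hy, hgt.eq_of_nhds]
  rw [A.bracketAt_congr (.of_forall fun _ ↦ rfl) hT, A.bracketAt_congr (.of_forall fun _ ↦ rfl) hc,
    map_sum, map_sum]
  have hl : ∀ i, A.bracketAt x s (T i) = φ i (g x) • A.bracketAt x s (s' i) +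
      φ i (dirDeriv 𝓘(ℝ, EM) (fun y ↦ coordAt F x (t y)) x (A.anchor x (s x))) •
        ofCoord F E x x (b i) := fun i ↦ by
    have h := A.leibniz s (s' i) _ (hf i) x
    rw [dirDeriv_clm (φ i) (hg.mdifferentiable (by simp) x), dirDeriv_congr hgt,
      hs'.self_of_nhds i] at h
    exact h
  simp only [hl, map_smul]
  rw [Finset.sum_add_distrib, ← hcoord x hx, add_comm]

/-- The bracket of sections in the preferred trivialization at `x`. -/
theorem bracketAt_eq (s t : Cₛ^∞⟮𝓘(ℝ, EM); F, E⟯) (x : M) :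
    A.bracketAt x s t =
      ofCoord F E x x (dirDeriv 𝓘(ℝ, EM) (fun y ↦ coordAt F x (t y)) x (A.anchor x (s x)) -
        dirDeriv 𝓘(ℝ, EM) (fun y ↦ coordAt F x (s y)) x (A.anchor x (t x))) +
        A.structureMap x (s x) (t x) := by
  have hx := mem_baseSet_self (F := F) (E := E) x
  rw [A.bracketAt_eq_add_localConst_right, A.bracketAt_skew x s,
    A.bracketAt_eq_add_localConst_right, localConst_self, A.bracketAt_skew x (localConst _)]
  rw [sub_eq_add_neg, ofCoord_add hx, ← neg_one_smul ℝ (dirDeriv _ _ _ _), ofCoord_smul hx,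
    neg_one_smul, neg_add, neg_neg, add_assoc]
  rfl

end LieAlgebroid

end

section

/-! ### Smoothness of derivatives, and the anchor in coordinates -/

section DirDerivSmooth

variable {EP : Type*} [NormedAddCommGroup EP] [NormedSpace ℝ EP]
  {HP : Type*} [TopologicalSpace HP] {IP : ModelWithCorners ℝ EP HP}
  {P : Type*} [TopologicalSpace P] [ChartedSpace HP P] [IsManifold IP ∞ P]
  {W : Type*} [NormedAddCommGroup W] [NormedSpace ℝ W]

/-- The derivative of a smooth function along a smooth vector field is smooth. -/
theorem contMDiffAt_dirDeriv {g : P → W} {U : ∀ z : P, TangentSpace IP z} {w : P} {u : Set P}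
    (hu : IsOpen u) (hw : w ∈ u) (hg : ContMDiffOn IP 𝓘(ℝ, W) ∞ g u)
    (hU : ContMDiffAt IP IP.tangent ∞ (fun z ↦ (⟨z, U z⟩ : TangentBundle IP P)) w) :
    ContMDiffAt IP 𝓘(ℝ, W) ∞ (fun z ↦ dirDeriv IP g z (U z)) w := by
  have : IsManifold IP 1 P := .of_le (n := ∞) (by simp)
  have h1 := hg.contMDiffOn_tangentMapWithin (m := ∞) (by simp) hu.uniqueMDiffOn
  have h2 := (h1.contMDiffAt (x := (⟨w, U w⟩ : TangentBundle IP P))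
    ((hu.preimage (FiberBundle.continuous_proj EP (TangentSpace IP : P → Type _))).mem_nhds hw)).comp
    w hU
  have h3 := (contMDiff_snd_tangentBundle_modelSpace (n := ∞) W 𝓘(ℝ, W)).contMDiffAt.comp w h2
  refine h3.congr_of_eventuallyEq ?_
  filter_upwards [hu.mem_nhds hw] with z hz
  unfold dirDeriv
  rw [← mfderivWithin_of_isOpen hu hz]
  rfl

end DirDerivSmooth

namespace LieAlgebroid

variable {EM : Type*} [NormedAddCommGroup EM] [NormedSpace ℝ EM] [FiniteDimensional ℝ EM]
  {M : Type*} [TopologicalSpace M] [ChartedSpace EM M] [IsManifold 𝓘(ℝ, EM) ∞ M] [T2Space M]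
  {F : Type*} [NormedAddCommGroup F] [NormedSpace ℝ F] [FiniteDimensional ℝ F]
  {E : M → Type*} [TopologicalSpace (TotalSpace F E)]
  [∀ x, AddCommGroup (E x)] [∀ x, Module ℝ (E x)] [∀ x, TopologicalSpace (E x)]
  [FiberBundle F E] [VectorBundle ℝ F E] [ContMDiffVectorBundle ∞ F E 𝓘(ℝ, EM)]
  (A : LieAlgebroid EM F E)

/-- The anchor in the preferred trivialization and the preferred chart at `x₀`. -/
def anchorCoord (x₀ y : M) : F →L[ℝ] EM :=
  LinearMap.toContinuousLinearMap
    { toFun := fun c ↦ dirDeriv 𝓘(ℝ, EM) (extChartAt 𝓘(ℝ, EM) x₀) y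
        (A.anchor y ((trivializationAt F E x₀).symmₗ ℝ y c))
      map_add' := fun c d ↦ by rw [map_add, map_add, dirDeriv_vec_add]
      map_smul' := fun r c ↦ by rw [map_smul, map_smul, dirDeriv_vec_smul, RingHom.id_apply] }

theorem anchorCoord_apply {x₀ y : M} (hy : y ∈ (trivializationAt F E x₀).baseSet) (c : F) :
    A.anchorCoord x₀ y c =
      dirDeriv 𝓘(ℝ, EM) (extChartAt 𝓘(ℝ, EM) x₀) y (A.anchor y (ofCoord F E x₀ y c)) := by
  have h : (trivializationAt F E x₀).symmₗ ℝ y c = ofCoord F E x₀ y c :=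
    (trivializationAt F E x₀).symmₗ_apply hy c
  rw [← h]
  rfl

theorem anchorCoord_coordAt {x₀ y : M} (hy : y ∈ (trivializationAt F E x₀).baseSet) (u : E y) :
    A.anchorCoord x₀ y (coordAt F x₀ u) =
      dirDeriv 𝓘(ℝ, EM) (extChartAt 𝓘(ℝ, EM) x₀) y (A.anchor y u) := by
  rw [A.anchorCoord_apply hy, ofCoord_coordAt hy]

theorem contMDiffAt_anchorCoord_of_mem {x y : M}
    (hy : y ∈ (trivializationAt F E x).baseSet) (hy' : y ∈ (chartAt EM x).source) :
    ContMDiffAt 𝓘(ℝ, EM) 𝓘(ℝ, F →L[ℝ] EM) ∞ (A.anchorCoord x) y := by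
  refine contMDiffAt_clm_of_apply fun c ↦ ?_
  have h : ContMDiffAt 𝓘(ℝ, EM) 𝓘(ℝ, EM).tangent ∞
      (fun y ↦ (⟨y, A.anchor y (ofCoord F E x y c)⟩ : TangentBundle 𝓘(ℝ, EM) M)) y :=
    ContMDiffAt.comp y A.contMDiff_anchor.contMDiffAt (contMDiffAt_ofCoord hy c)
  refine (contMDiffAt_dirDeriv (chartAt EM x).open_source hy' contMDiffOn_extChartAt
    h).congr_of_eventuallyEq ?_
  filter_upwards [(trivializationAt F E x).open_baseSet.mem_nhds hy] with y hy
  exact A.anchorCoord_apply hy c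

theorem contMDiffAt_anchorCoord (x : M) :
    ContMDiffAt 𝓘(ℝ, EM) 𝓘(ℝ, F →L[ℝ] EM) ∞ (A.anchorCoord x) x :=
  A.contMDiffAt_anchorCoord_of_mem (mem_baseSet_self x) (mem_chart_source EM x)

theorem anchor_eq_anchorCoord (x : M) (u : E x) :
    A.anchor x u = (A.anchorCoord x x (coordAt F x u) : EM) := by
  rw [A.anchorCoord_coordAt (mem_baseSet_self x), dirDeriv_extChartAt_self]

theorem contMDiffAt_anchor_section (s : Cₛ^∞⟮𝓘(ℝ, EM); F, E⟯) (x : M) :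
    ContMDiffAt 𝓘(ℝ, EM) 𝓘(ℝ, EM).tangent ∞
      (fun y ↦ (⟨y, A.anchor y (s y)⟩ : TangentBundle 𝓘(ℝ, EM) M)) x :=
  ContMDiffAt.comp x A.contMDiff_anchor.contMDiffAt s.contMDiff.contMDiffAt

/-- This is `anchor_bracket` for constant-coordinate sections: only the anchor matrix varies, so the
Lie bracket of the image fields is the antisymmetrized derivative of that matrix. In classical
notation it is the structure equation relating $\sigma^i_\alpha$ and the structure functions. -/
theorem anchor_structureMap (x : M) (u v : E x) :
    A.anchor x (A.structureMap x u v) =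
      (dirDeriv 𝓘(ℝ, EM) (A.anchorCoord x) x (A.anchor x u) (coordAt F x v) -
        dirDeriv 𝓘(ℝ, EM) (A.anchorCoord x) x (A.anchor x v) (coordAt F x u) : EM) := by
  have hd : ∀ (u v : E x), dirDeriv 𝓘(ℝ, EM) (fun y ↦ dirDeriv 𝓘(ℝ, EM)
      (extChartAt 𝓘(ℝ, EM) x) y (A.anchor y (localConst (EM := EM) (F := F) v y))) x
        (A.anchor x u) =
      dirDeriv 𝓘(ℝ, EM) (A.anchorCoord x) x (A.anchor x u) (coordAt F x v) := by
    intro u v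
    have h1 : (fun y ↦ dirDeriv 𝓘(ℝ, EM) (extChartAt 𝓘(ℝ, EM) x) y
        (A.anchor y (localConst (EM := EM) (F := F) v y))) =ᶠ[𝓝 x]
        fun y ↦ A.anchorCoord x y (coordAt F x v) := by
      filter_upwards [eventually_mem_baseSet (F := F) (E := E) x,
        localConst_eventuallyEq_ofCoord (EM := EM) (F := F) v] with y hy h
      rw [h, A.anchorCoord_apply hy]
    rw [dirDeriv_congr h1, dirDeriv_clm_apply
      ((A.contMDiffAt_anchorCoord x).mdifferentiableAt (by simp)) mdifferentiableAt_const,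
      dirDeriv_const, map_zero, add_zero]
  rw [structureMap_apply, A.anchor_bracket, mlieBracket_eq_dirDeriv_sub
    (A.contMDiffAt_anchor_section _ x) (A.contMDiffAt_anchor_section _ x), localConst_self,
    localConst_self, hd, hd]

/-! ### The bracket of the prolongation in coordinates -/

section Prolongation

variable {EP : Type*} [NormedAddCommGroup EP] [NormedSpace ℝ EP]
  {HP : Type*} [TopologicalSpace HP] {IP : ModelWithCorners ℝ EP HP}
  {P : Type*} [TopologicalSpace P] [ChartedSpace HP P] [IsManifold IP ∞ P]
  {A} {p : P → M}

theorem anchor_fst {w : P} (a : A.prolFiber IP p w) :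
    A.anchor (p w) a.1.1 = mfderiv IP 𝓘(ℝ, EM) p w a.1.2 := a.2

theorem bracketFst_eq (ρ₁ ρ₂ : ∀ w, A.prolFiber IP p w) (w : P) :
    A.bracketFst ρ₁ ρ₂ w =
      ofCoord F E (p w) (p w)
        (dirDeriv IP (fun z ↦ coordAt F (p w) (ρ₂ z).1.1) w (ρ₁ w).1.2 -
          dirDeriv IP (fun z ↦ coordAt F (p w) (ρ₁ z).1.1) w (ρ₂ w).1.2) +
      A.structureMap (p w) (ρ₁ w).1.1 (ρ₂ w).1.1 := rfl

theorem IsSmooth.coord {ρ : ∀ w, A.prolFiber IP p w} (hρ : A.IsSmooth ρ) {x₀ : M} {w : P}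
    (hw : p w ∈ (trivializationAt F E x₀).baseSet) :
    ContMDiffAt IP 𝓘(ℝ, F) ∞ (fun z ↦ coordAt F x₀ (ρ z).1.1) w :=
  contMDiffAt_coordAt hw hρ.fst.contMDiffAt

/-- The anchor of a section of the prolongation in coordinates. -/
theorem map_dirDeriv_extChartAt (ρ : ∀ w, A.prolFiber IP p w)
    (hp : ContMDiff IP 𝓘(ℝ, EM) ∞ p) {w : P} (L : EP →L[ℝ] EM)
    (hL : ∀ᶠ z in 𝓝 w, extChartAt 𝓘(ℝ, EM) (p w) (p z) = L (extChartAt IP w z)) :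
    ∀ᶠ z in 𝓝 w, L (dirDeriv IP (extChartAt IP w) z (ρ z).1.2) =
      A.anchorCoord (p w) (p z) (coordAt F (p w) (ρ z).1.1) := by
  have : IsManifold IP 1 P := .of_le (n := ∞) (by simp)
  have hpc := hp.continuous.continuousAt (x := w)
  filter_upwards [hL.eventually_nhds, chart_source_mem_nhds HP w,
    hpc.eventually (chart_source_mem_nhds EM (p w)),
    hpc.eventually (eventually_mem_baseSet (F := F) (E := E) (p w))] with z hz hs hps hb
  rw [A.anchorCoord_coordAt hb, anchor_fst,
    ← dirDeriv_comp (mdifferentiableAt_extChartAt hps) (hp.mdifferentiable (by simp) z),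
    dirDeriv_congr hz, dirDeriv_clm L (mdifferentiableAt_extChartAt hs)]

/-- The bracket of smooth sections of the prolongation takes values in the prolongation. -/
theorem IsSmooth.bracket_mem [IP.Boundaryless] [CompleteSpace EP]
    {ρ₁ ρ₂ : ∀ w, A.prolFiber IP p w} (h₁ : A.IsSmooth ρ₁) (h₂ : A.IsSmooth ρ₂)
    (hp : ContMDiff IP 𝓘(ℝ, EM) ∞ p) {w : P} (L : EP →L[ℝ] EM)
    (hL : ∀ᶠ z in 𝓝 w, extChartAt 𝓘(ℝ, EM) (p w) (p z) = L (extChartAt IP w z)) :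
    (A.bracketFst ρ₁ ρ₂ w, mlieBracket IP (fun z ↦ (ρ₁ z).1.2) (fun z ↦ (ρ₂ z).1.2) w) ∈
      A.prolFiber IP p w := by
  have hx := mem_baseSet_self (F := F) (E := E) (p w)
  have hpd := hp.mdifferentiable (by simp) w
  -- `p` is `L` in the preferred charts, and both charts have the identity as differential at their
  -- base points.
  have hT : ∀ v : TangentSpace IP w, mfderiv IP 𝓘(ℝ, EM) p w v = L v := fun v ↦ by
    have h := dirDeriv_comp (f := extChartAt 𝓘(ℝ, EM) (p w))
      (mdifferentiableAt_extChartAt (mem_chart_source EM (p w))) hpd v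
    rw [dirDeriv_extChartAt_self, dirDeriv_congr hL, dirDeriv_clm L
      (mdifferentiableAt_extChartAt (mem_chart_source HP w)), dirDeriv_extChartAt_self] at h
    exact h.symm
  -- Differentiate the coordinate form of the membership condition for `ρ'` along `ρ`. After
  -- antisymmetrizing, the terms with the derivative of the anchor matrix are exactly those of
  -- `anchor_structureMap`.
  have key : ∀ (ρ : ∀ w, A.prolFiber IP p w) {ρ' : ∀ w, A.prolFiber IP p w}, A.IsSmooth ρ' →
      L (dirDeriv IP (fun z ↦ dirDeriv IP (extChartAt IP w) z (ρ' z).1.2) w (ρ w).1.2) =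
      dirDeriv 𝓘(ℝ, EM) (A.anchorCoord (p w)) (p w) (A.anchor (p w) (ρ w).1.1)
        (coordAt F (p w) (ρ' w).1.1) +
      A.anchorCoord (p w) (p w)
        (dirDeriv IP (fun z ↦ coordAt F (p w) (ρ' z).1.1) w (ρ w).1.2) := by
    intro ρ ρ' hρ'
    have ha := (A.contMDiffAt_anchorCoord (p w)).mdifferentiableAt (by simp)
    rw [← dirDeriv_clm L (hρ'.snd.contMDiffAt.dirDeriv_extChartAt.mdifferentiableAt (by simp)),
      dirDeriv_congr (map_dirDeriv_extChartAt ρ' hp L hL),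
      dirDeriv_clm_apply (L := fun z ↦ A.anchorCoord (p w) (p z))
        (ha.comp w hpd) ((hρ'.coord hx).mdifferentiableAt (by simp)),
      dirDeriv_comp ha hpd, anchor_fst]
  change A.anchor (p w) (A.bracketFst ρ₁ ρ₂ w) = mfderiv IP 𝓘(ℝ, EM) p w
    (mlieBracket IP (fun z ↦ (ρ₁ z).1.2) (fun z ↦ (ρ₂ z).1.2) w)
  rw [hT, mlieBracket_eq_dirDeriv_sub h₁.snd.contMDiffAt h₂.snd.contMDiffAt, bracketFst_eq,
    map_add, anchor_structureMap, anchor_eq_anchorCoord, coordAt_ofCoord hx]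
  have h3 := congrArg₂ (· - ·) (key ρ₁ h₂) (key ρ₂ h₁)
  refine Eq.trans ?_ (h3.symm.trans (map_sub L _ _).symm)
  rw [map_sub]
  exact (sub_add_sub_comm _ _ _ _).trans (congrArg₂ (· - ·) (add_comm _ _) (add_comm _ _))

/-- The bracket of sections of the prolongation in a local frame `s` of `E` with constant
coordinates in the preferred trivialization at a nearby point `x₀`. -/
theorem IsSmooth.coordAt_bracketFst {ρ₁ ρ₂ : ∀ w, A.prolFiber IP p w} (h₁ : A.IsSmooth ρ₁)
    (h₂ : A.IsSmooth ρ₂) (hp : ContMDiff IP 𝓘(ℝ, EM) ∞ p) {w : P} {x₀ : M}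
    (hw : p w ∈ (trivializationAt F E x₀).baseSet) (s : F →ₗ[ℝ] Cₛ^∞⟮𝓘(ℝ, EM); F, E⟯)
    (hs : ∀ c, ∀ᶠ y in 𝓝 (p w), s c y = ofCoord F E x₀ y c) :
    coordAt F x₀ (A.bracketFst ρ₁ ρ₂ w) =
      dirDeriv IP (fun z ↦ coordAt F x₀ (ρ₂ z).1.1) w (ρ₁ w).1.2 -
      dirDeriv IP (fun z ↦ coordAt F x₀ (ρ₁ z).1.1) w (ρ₂ w).1.2 +
      coordAt F x₀ (A.bracketAt (p w) (s (coordAt F x₀ (ρ₁ w).1.1))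
        (s (coordAt F x₀ (ρ₂ w).1.1))) := by
  have hx := mem_baseSet_self (F := F) (E := E) (p w)
  have hpd := hp.mdifferentiable (by simp) w
  have hpc := hp.continuous.continuousAt (x := w)
  -- `bracketFst` uses the trivialization at `p w` itself, which moves with `w`. `T` compares it
  -- with the fixed one at `x₀`.
  let T : M → F →L[ℝ] F := fun y ↦
    ((trivializationAt F E x₀).coordChangeL ℝ (trivializationAt F E (p w)) y : F →L[ℝ] F)
  have hTsm : MDifferentiableAt 𝓘(ℝ, EM) 𝓘(ℝ, F →L[ℝ] F) T (p w) :=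
    (contMDiffAt_coordChangeL (n := ∞) hw hx).mdifferentiableAt (by simp)
  have hTapp : ∀ y ∈ (trivializationAt F E x₀).baseSet,
      y ∈ (trivializationAt F E (p w)).baseSet → ∀ c, T y c = coordAt F (p w)
        (ofCoord F E x₀ y c) := fun y hy hy' c ↦
    (trivializationAt F E x₀).coordChangeL_apply _ ⟨hy, hy'⟩ c
  have hnb : ∀ᶠ y in 𝓝 (p w), y ∈ (trivializationAt F E x₀).baseSet ∧
      y ∈ (trivializationAt F E (p w)).baseSet :=
    Filter.Eventually.and ((trivializationAt F E x₀).open_baseSet.mem_nhds hw)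
      (eventually_mem_baseSet (p w))
  -- The derivative of `T` coming from the product rule is the derivative of the coordinates of a
  -- frame section. `bracketAt_eq` absorbs it into the bracket of frame sections.
  have hD : ∀ (ρ : ∀ w, A.prolFiber IP p w) {ρ' : ∀ w, A.prolFiber IP p w}, A.IsSmooth ρ' →
      dirDeriv IP (fun z ↦ coordAt F (p w) (ρ' z).1.1) w (ρ w).1.2 =
      dirDeriv 𝓘(ℝ, EM) (fun y ↦ coordAt F (p w) (s (coordAt F x₀ (ρ' w).1.1) y)) (p w)
        (A.anchor (p w) (ρ w).1.1) +
      T (p w) (dirDeriv IP (fun z ↦ coordAt F x₀ (ρ' z).1.1) w (ρ w).1.2) := by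
    intro ρ ρ' hρ'
    have e1 : (fun z ↦ coordAt F (p w) (ρ' z).1.1) =ᶠ[𝓝 w]
        fun z ↦ T (p z) (coordAt F x₀ (ρ' z).1.1) := by
      filter_upwards [hpc.eventually hnb] with z hz
      rw [hTapp _ hz.1 hz.2, ofCoord_coordAt hz.1]
    have e2 : (fun y ↦ coordAt F (p w) (s (coordAt F x₀ (ρ' w).1.1) y)) =ᶠ[𝓝 (p w)]
        fun y ↦ T y (coordAt F x₀ (ρ' w).1.1) := by
      filter_upwards [hnb, hs (coordAt F x₀ (ρ' w).1.1)] with y hy hsy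
      rw [hsy, hTapp _ hy.1 hy.2]
    rw [dirDeriv_congr e1, dirDeriv_congr e2, dirDeriv_clm_apply (L := fun z ↦ T (p z))
      (hTsm.comp w hpd) ((hρ'.coord hw).mdifferentiableAt (by simp)),
      dirDeriv_comp hTsm hpd, dirDeriv_clm_apply hTsm mdifferentiableAt_const, dirDeriv_const,
      map_zero, add_zero, anchor_fst]
  have hsw : ∀ ρ : ∀ w, A.prolFiber IP p w, s (coordAt F x₀ (ρ w).1.1) (p w) = (ρ w).1.1 :=
    fun ρ ↦ by rw [(hs _).self_of_nhds, ofCoord_coordAt hw]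
  have hoT : ∀ c, ofCoord F E (p w) (p w) (T (p w) c) = ofCoord F E x₀ (p w) c := fun c ↦ by
    rw [hTapp _ hw hx, ofCoord_coordAt hx]
  have hsplit : A.bracketFst ρ₁ ρ₂ w =
      ofCoord F E x₀ (p w) (dirDeriv IP (fun z ↦ coordAt F x₀ (ρ₂ z).1.1) w (ρ₁ w).1.2 -
        dirDeriv IP (fun z ↦ coordAt F x₀ (ρ₁ z).1.1) w (ρ₂ w).1.2) +
      A.bracketAt (p w) (s (coordAt F x₀ (ρ₁ w).1.1)) (s (coordAt F x₀ (ρ₂ w).1.1)) := by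
    rw [bracketFst_eq, bracketAt_eq, hD ρ₁ h₂, hD ρ₂ h₁, hsw, hsw, ← hoT, map_sub, ← add_assoc,
      ← ofCoord_add hx]
    congr 2
    abel
  rw [hsplit, coordAt_add hw, coordAt_ofCoord hw]

end Prolongation

end LieAlgebroid

end

section

/-! ### Projections are linear in charts; smoothness of the prolonged bracket -/

section ChartLinear

variable {EM : Type*} [NormedAddCommGroup EM] [NormedSpace ℝ EM]
  {M : Type*} [TopologicalSpace M] [ChartedSpace EM M]
  {EP : Type*} [NormedAddCommGroup EP] [NormedSpace ℝ EP]
  {HP : Type*} [TopologicalSpace HP] (IP : ModelWithCorners ℝ EP HP)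
  {P : Type*} [TopologicalSpace P] [ChartedSpace HP P]

/-- A smooth map which is linear in the preferred charts. -/
structure IsChartLinear (p : P → M) : Prop where
  contMDiff : ContMDiff IP 𝓘(ℝ, EM) ∞ p
  exists_linear : ∀ w, ∃ L : EP →L[ℝ] EM,
    ∀ᶠ z in 𝓝 w, extChartAt 𝓘(ℝ, EM) (p w) (p z) = L (extChartAt IP w z)

theorem extChartAt_totalSpace_apply {G : Type*} [NormedAddCommGroup G] [NormedSpace ℝ G]
    {V : M → Type*} [TopologicalSpace (TotalSpace G V)] [∀ x, TopologicalSpace (V x)]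
    [FiberBundle G V] {w z : TotalSpace G V}
    (hz : z.proj ∈ (trivializationAt G V w.proj).baseSet) :
    extChartAt (𝓘(ℝ, EM).prod 𝓘(ℝ, G)) w z =
      (extChartAt 𝓘(ℝ, EM) w.proj z.proj, (trivializationAt G V w.proj z).2) := by
  rw [FiberBundle.extChartAt]
  have h : (trivializationAt G V w.proj z).1 = z.proj :=
    (trivializationAt G V w.proj).coe_fst' hz
  simp [h]

theorem isChartLinear_proj {G : Type*} [NormedAddCommGroup G] [NormedSpace ℝ G]
    (V : M → Type*) [TopologicalSpace (TotalSpace G V)] [∀ x, TopologicalSpace (V x)]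
    [FiberBundle G V] [∀ x, AddCommGroup (V x)] [∀ x, Module ℝ (V x)] [VectorBundle ℝ G V]
    [IsManifold 𝓘(ℝ, EM) ∞ M] :
    IsChartLinear (EM := EM) (𝓘(ℝ, EM).prod 𝓘(ℝ, G))
      (TotalSpace.proj : TotalSpace G V → M) where
  contMDiff := contMDiff_proj V
  exists_linear w := by
    refine ⟨ContinuousLinearMap.fst ℝ EM G, ?_⟩
    have hc : ContinuousAt (TotalSpace.proj : TotalSpace G V → M) w :=
      (FiberBundle.continuous_proj G V).continuousAt
    filter_upwards [hc.eventually ((trivializationAt G V w.proj).open_baseSet.mem_nhds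
      (mem_baseSet_trivializationAt G V w.proj))] with z hz
    rw [extChartAt_totalSpace_apply hz]
    rfl

end ChartLinear

namespace LieAlgebroid

variable {EM : Type*} [NormedAddCommGroup EM] [NormedSpace ℝ EM] [FiniteDimensional ℝ EM]
  {M : Type*} [TopologicalSpace M] [ChartedSpace EM M] [IsManifold 𝓘(ℝ, EM) ∞ M] [T2Space M]
  {F : Type*} [NormedAddCommGroup F] [NormedSpace ℝ F] [FiniteDimensional ℝ F]
  {E : M → Type*} [TopologicalSpace (TotalSpace F E)]
  [∀ x, AddCommGroup (E x)] [∀ x, Module ℝ (E x)] [∀ x, TopologicalSpace (E x)]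
  [FiberBundle F E] [VectorBundle ℝ F E] [ContMDiffVectorBundle ∞ F E 𝓘(ℝ, EM)]
  {A : LieAlgebroid EM F E}
  {EP : Type*} [NormedAddCommGroup EP] [NormedSpace ℝ EP] [CompleteSpace EP]
  {HP : Type*} [TopologicalSpace HP] {IP : ModelWithCorners ℝ EP HP} [IP.Boundaryless]
  {P : Type*} [TopologicalSpace P] [ChartedSpace HP P] [IsManifold IP ∞ P]
  {p : P → M}

variable (F E) in
/-- Near every point of `M` there is a linear family of sections of `E` which have constant
coordinates there. -/
theorem exists_frame (x₀ : M) : ∃ s : F →ₗ[ℝ] Cₛ^∞⟮𝓘(ℝ, EM); F, E⟯,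
    ∀ᶠ y in 𝓝 x₀, ∀ c, s c y = ofCoord F E x₀ y c := by
  let b := Module.finBasis ℝ F
  have hx := mem_baseSet_self (F := F) (E := E) x₀
  let s' : Fin (Module.finrank ℝ F) → Cₛ^∞⟮𝓘(ℝ, EM); F, E⟯ :=
    fun i ↦ localConst (ofCoord F E x₀ x₀ (b i))
  have hs' : ∀ᶠ y in 𝓝 x₀, ∀ i, s' i y = ofCoord F E x₀ y (b i) := by
    refine eventually_all.2 fun i ↦ ?_
    filter_upwards [localConst_eventuallyEq_ofCoord (EM := EM) (F := F) (ofCoord F E x₀ x₀ (b i))]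
      with y hy
    rw [hy, coordAt_ofCoord hx]
  refine ⟨b.constr ℝ s', ?_⟩
  filter_upwards [hs', eventually_mem_baseSet (F := F) (E := E) x₀] with y hy hb c
  let ev : Cₛ^∞⟮𝓘(ℝ, EM); F, E⟯ →ₗ[ℝ] E y :=
    { toFun := fun s ↦ s y, map_add' := fun _ _ ↦ rfl, map_smul' := fun _ _ ↦ rfl }
  let oc : F →ₗ[ℝ] E y :=
    { toFun := ofCoord F E x₀ y, map_add' := ofCoord_add hb, map_smul' := ofCoord_smul hb }
  have h : ev ∘ₗ b.constr ℝ s' = oc := b.ext fun i ↦ by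
    simp only [LinearMap.comp_apply, Module.Basis.constr_basis]
    exact hy i
  exact DFunLike.congr_fun h c

theorem IsSmooth.prolBracket_coe {ρ₁ ρ₂ : ∀ w, A.prolFiber IP p w} (h₁ : A.IsSmooth ρ₁)
    (h₂ : A.IsSmooth ρ₂) (hp : IsChartLinear (EM := EM) IP p) (w : P) :
    (A.prolBracket ρ₁ ρ₂ w).1 = (A.bracketFst ρ₁ ρ₂ w,
      mlieBracket IP (fun z ↦ (ρ₁ z).1.2) (fun z ↦ (ρ₂ z).1.2) w) := by
  obtain ⟨L, hL⟩ := hp.exists_linear w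
  rw [prolBracket, dif_pos (h₁.bracket_mem h₂ hp.contMDiff L hL)]

/-- The bracket of smooth sections of the prolongation is smooth. -/
theorem IsSmooth.prolBracket {ρ₁ ρ₂ : ∀ w, A.prolFiber IP p w} (h₁ : A.IsSmooth ρ₁)
    (h₂ : A.IsSmooth ρ₂) (hp : IsChartLinear (EM := EM) IP p) :
    A.IsSmooth (A.prolBracket ρ₁ ρ₂) where
  snd w := by
    have : (fun w ↦ (⟨w, (A.prolBracket ρ₁ ρ₂ w).1.2⟩ : TangentBundle IP P)) =
        fun w ↦ ⟨w, mlieBracket IP (fun z ↦ (ρ₁ z).1.2) (fun z ↦ (ρ₂ z).1.2) w⟩ :=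
      funext fun w ↦ by rw [h₁.prolBracket_coe h₂ hp]
    rw [this]
    have : IsManifold IP (minSmoothness ℝ 2) P :=
      .of_le (n := ∞) (by
        simpa using (WithTop.coe_le_coe.2 le_top : ((2 : ℕ∞) : WithTop ℕ∞) ≤ ∞))
    -- `∞ + 1` is `∞` by definition.
    have : IsManifold IP (((⊤ : ℕ∞) : WithTop ℕ∞) + 1) P := ‹IsManifold IP ∞ P›
    exact ContMDiffAt.mlieBracket_vectorField (m := ⊤) (n := ⊤) h₁.snd.contMDiffAt
      h₂.snd.contMDiffAt (by simp)
  fst w₀ := by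
    have hpc := hp.contMDiff.continuous
    obtain ⟨s, hs⟩ := exists_frame (EM := EM) F E (p w₀)
    let b := Module.finBasis ℝ F
    let φ : Fin (Module.finrank ℝ F) → F →L[ℝ] ℝ :=
      fun i ↦ LinearMap.toContinuousLinearMap (b.coord i)
    have hφ : ∀ c, ∑ i, φ i c • b i = c := fun c ↦ b.sum_repr c
    have hw₀ := mem_baseSet_self (F := F) (E := E) (p w₀)
    have hob : IsOpen (p ⁻¹' (trivializationAt F E (p w₀)).baseSet) :=
      (trivializationAt F E (p w₀)).open_baseSet.preimage hpc
    refine contMDiffAt_of_coordAt hw₀ hp.contMDiff.contMDiffAt ?_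
    -- All terms are written in the one trivialization at `p w₀`. Expanding in a basis replaces the
    -- `w`-dependent frame sections by finitely many fixed ones, whose brackets are smooth.
    have hsm : ContMDiffAt IP 𝓘(ℝ, F) ∞ (fun w ↦
        dirDeriv IP (fun z ↦ coordAt F (p w₀) (ρ₂ z).1.1) w (ρ₁ w).1.2 -
        dirDeriv IP (fun z ↦ coordAt F (p w₀) (ρ₁ z).1.1) w (ρ₂ w).1.2 +
        ∑ i, ∑ j, (φ i (coordAt F (p w₀) (ρ₁ w).1.1) * φ j (coordAt F (p w₀) (ρ₂ w).1.1)) •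
          coordAt F (p w₀) (A.bracket (s (b i)) (s (b j)) (p w))) w₀ := by
      refine ((contMDiffAt_dirDeriv hob hw₀ (fun z hz ↦ (h₂.coord hz).contMDiffWithinAt)
        h₁.snd.contMDiffAt).sub (contMDiffAt_dirDeriv hob hw₀
          (fun z hz ↦ (h₁.coord hz).contMDiffWithinAt) h₂.snd.contMDiffAt)).add ?_
      refine contMDiffAt_finsetSum fun i _ ↦ contMDiffAt_finsetSum fun j _ ↦ ?_
      refine ContMDiffAt.smul (ContMDiffAt.mul ((φ i).contMDiff.contMDiffAt.comp w₀ (h₁.coord hw₀))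
        ((φ j).contMDiff.contMDiffAt.comp w₀ (h₂.coord hw₀))) ?_
      exact contMDiffAt_coordAt (p := p) hw₀
        ((A.bracket (s (b i)) (s (b j))).contMDiff.contMDiffAt.comp w₀ hp.contMDiff.contMDiffAt)
    refine hsm.congr_of_eventuallyEq ?_
    filter_upwards [hpc.continuousAt.eventually hs.eventually_nhds, hob.mem_nhds hw₀] with w hsw hw
    rw [h₁.prolBracket_coe h₂ hp, h₁.coordAt_bracketFst h₂ hp.contMDiff hw s
      (fun c ↦ hsw.mono fun y hy ↦ hy c)]
    congr 1
    conv_lhs => rw [← hφ (coordAt F (p w₀) (ρ₁ w).1.1), ← hφ (coordAt F (p w₀) (ρ₂ w).1.1)]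
    simp only [map_sum, map_smul, LinearMap.sum_apply, LinearMap.smul_apply, coordAt_sum hw,
      coordAt_smul hw, bracketAt_apply, Finset.smul_sum, smul_smul]
    refine Finset.sum_comm.trans ?_
    simp only [mul_comm]

end LieAlgebroid

end

section

/-! ### Vertical lifts in coordinates -/

section VerticalLift

variable {EM : Type*} [NormedAddCommGroup EM] [NormedSpace ℝ EM]
  {M : Type*} [TopologicalSpace M] [ChartedSpace EM M] [IsManifold 𝓘(ℝ, EM) ∞ M]
  {G : Type*} [NormedAddCommGroup G] [NormedSpace ℝ G]
  {V : M → Type*} [TopologicalSpace (TotalSpace G V)]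
  [∀ x, AddCommGroup (V x)] [∀ x, Module ℝ (V x)] [∀ x, TopologicalSpace (V x)]
  [FiberBundle G V] [VectorBundle ℝ G V]
  {W : Type*} [NormedAddCommGroup W] [NormedSpace ℝ W]

theorem fiberLine_zero (w : TotalSpace G V) (a : V w.proj) : fiberLine w a 0 = w := by
  simp [fiberLine]

/-- Chart domains of the total space are unions of whole fibres. Thus vertical lines stay in them,
and cutoffs can be pulled back from the base. -/
theorem mem_chart_source_totalSpace_iff {w z : TotalSpace G V} :
    z ∈ (chartAt (ModelProd EM G) w).source ↔
      z.proj ∈ (chartAt EM w.proj).source ∧ z.proj ∈ (trivializationAt G V w.proj).baseSet := by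
  rw [FiberBundle.chartedSpace_chartAt]
  simp only [OpenPartialHomeomorph.trans_source, Set.mem_inter_iff, Set.mem_preimage,
    OpenPartialHomeomorph.prod_source, OpenPartialHomeomorph.refl_source, Set.mem_prod,
    Set.mem_univ, and_true]
  constructor
  · rintro ⟨h1, h2⟩
    have h1' := (trivializationAt G V w.proj).mem_source.1 h1
    refine ⟨?_, h1'⟩
    rwa [← (trivializationAt G V w.proj).coe_fst' h1']
  · rintro ⟨h1, h2⟩
    refine ⟨(trivializationAt G V w.proj).mem_source.2 h2, ?_⟩
    rwa [← (trivializationAt G V w.proj).coe_fst' h2] at h1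

theorem coordAt_add_smul {x₀ x : M} (hx : x ∈ (trivializationAt G V x₀).baseSet) (u a : V x)
    (t : ℝ) : coordAt G x₀ (u + t • a) = coordAt G x₀ u + t • coordAt G x₀ a := by
  rw [coordAt_add hx, coordAt_smul hx]

variable [ContMDiffVectorBundle ∞ G V 𝓘(ℝ, EM)]

theorem contMDiff_fiberLine (w : TotalSpace G V) (a : V w.proj) :
    ContMDiff 𝓘(ℝ, ℝ) (𝓘(ℝ, EM).prod 𝓘(ℝ, G)) ∞ (fiberLine w a) := by
  intro t
  refine contMDiffAt_of_coordAt (p := fun _ : ℝ ↦ w.proj) (u := fun t : ℝ ↦ w.2 + t • a)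
    (mem_baseSet_self w.proj) contMDiffAt_const ?_
  simp only [coordAt_add_smul (mem_baseSet_self w.proj)]
  exact (contDiff_const.add (contDiff_id.smul contDiff_const)).contMDiff.contMDiffAt

/-- The derivative along a vertical lift is the derivative along the corresponding line. -/
theorem hasDerivAt_dirDeriv_vertLift {f : TotalSpace G V → W} {w : TotalSpace G V}
    (hf : MDifferentiableAt (𝓘(ℝ, EM).prod 𝓘(ℝ, G)) 𝓘(ℝ, W) f w) (a : V w.proj) :
    HasDerivAt (fun t : ℝ ↦ f (fiberLine w a t))
      (dirDeriv (𝓘(ℝ, EM).prod 𝓘(ℝ, G)) f w (vertLift EM w a)) 0 := by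
  have hγ := (contMDiff_fiberLine (EM := EM) w a).mdifferentiable (by simp) (0 : ℝ)
  -- The chain rule gives the derivative of `f` at `fiberLine w a 0`, which equals `w` only
  -- propositionally. Generalizing the point allows the substitution inside dependent types.
  have key : ∀ z (hz : fiberLine w a 0 = z) (hf : MDifferentiableAt
      (𝓘(ℝ, EM).prod 𝓘(ℝ, G)) 𝓘(ℝ, W) f z),
      HasMFDerivAt 𝓘(ℝ, ℝ) 𝓘(ℝ, W) (fun t : ℝ ↦ f (fiberLine w a t)) 0
      ((mfderiv (𝓘(ℝ, EM).prod 𝓘(ℝ, G)) 𝓘(ℝ, W) f z).comp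
        (mfderiv 𝓘(ℝ, ℝ) (𝓘(ℝ, EM).prod 𝓘(ℝ, G)) (fiberLine w a) 0)) := by
    rintro _ rfl hf
    exact hf.hasMFDerivAt.comp (0 : ℝ) hγ.hasMFDerivAt
  let D : ℝ →L[ℝ] W := (mfderiv (𝓘(ℝ, EM).prod 𝓘(ℝ, G)) 𝓘(ℝ, W) f w).comp
    (mfderiv 𝓘(ℝ, ℝ) (𝓘(ℝ, EM).prod 𝓘(ℝ, G)) (fiberLine w a) 0)
  have h : HasFDerivAt (fun t : ℝ ↦ f (fiberLine w a t)) D 0 :=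
    (key w (fiberLine_zero w a) hf).hasFDerivAt
  exact h.hasDerivAt

theorem dirDeriv_extChartAt_vertLift {w z : TotalSpace G V}
    (hz : z ∈ (chartAt (ModelProd EM G) w).source) (a : V z.proj) :
    dirDeriv (𝓘(ℝ, EM).prod 𝓘(ℝ, G)) (extChartAt (𝓘(ℝ, EM).prod 𝓘(ℝ, G)) w) z
      (vertLift EM z a) = (0, coordAt G w.proj a) := by
  have : IsManifold (𝓘(ℝ, EM).prod 𝓘(ℝ, G)) 1 (TotalSpace G V) :=
    .of_le (n := ∞) (by simp)
  have hz' := (mem_chart_source_totalSpace_iff.1 hz).2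
  have h1 := hasDerivAt_dirDeriv_vertLift (EM := EM)
    (mdifferentiableAt_extChartAt (I := 𝓘(ℝ, EM).prod 𝓘(ℝ, G)) hz) a
  refine h1.unique ?_
  have h2 : (fun t : ℝ ↦ extChartAt (𝓘(ℝ, EM).prod 𝓘(ℝ, G)) w (fiberLine z a t)) =
      fun t : ℝ ↦ (extChartAt 𝓘(ℝ, EM) w.proj z.proj,
        coordAt G w.proj z.2 + t • coordAt G w.proj a) := by
    funext t
    rw [extChartAt_totalSpace_apply (z := fiberLine z a t) hz', ← coordAt_add_smul hz']
    rfl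
  rw [h2]
  refine (hasDerivAt_const _ _).prodMk ?_
  simpa using ((hasDerivAt_id (0 : ℝ)).smul_const (coordAt G w.proj a)).const_add
    (coordAt G w.proj z.2)

theorem vertLift_eq (w : TotalSpace G V) (a : V w.proj) :
    vertLift EM w a = ((0, coordAt G w.proj a) : EM × G) := by
  rw [← dirDeriv_extChartAt_vertLift (mem_chart_source _ w) a]
  exact (dirDeriv_extChartAt_self (IP := 𝓘(ℝ, EM).prod 𝓘(ℝ, G)) w (vertLift EM w a)).symm

theorem mfderiv_proj_apply (w : TotalSpace G V)
    (v : TangentSpace (𝓘(ℝ, EM).prod 𝓘(ℝ, G)) w) :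
    mfderiv (𝓘(ℝ, EM).prod 𝓘(ℝ, G)) 𝓘(ℝ, EM) (TotalSpace.proj : TotalSpace G V → M) w v =
      (v : EM × G).1 := by
  have : IsManifold 𝓘(ℝ, EM) 1 M := .of_le (n := ∞) (by simp)
  have : IsManifold (𝓘(ℝ, EM).prod 𝓘(ℝ, G)) 1 (TotalSpace G V) :=
    .of_le (n := ∞) (by simp)
  have hc : ContinuousAt (TotalSpace.proj : TotalSpace G V → M) w :=
    (FiberBundle.continuous_proj G V).continuousAt
  have h := dirDeriv_comp (f := extChartAt 𝓘(ℝ, EM) w.proj)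
    (p := (TotalSpace.proj : TotalSpace G V → M)) (w := w)
    (mdifferentiableAt_extChartAt (mem_chart_source EM w.proj))
    ((contMDiff_proj (n := ∞) V).mdifferentiable (by simp) w) v
  have hL : (fun z : TotalSpace G V ↦ extChartAt 𝓘(ℝ, EM) w.proj z.proj) =ᶠ[𝓝 w]
      fun z ↦ ContinuousLinearMap.fst ℝ EM G (extChartAt (𝓘(ℝ, EM).prod 𝓘(ℝ, G)) w z) := by
    filter_upwards [hc.eventually (eventually_mem_baseSet (F := G) (E := V) w.proj)] with z hz
    rw [extChartAt_totalSpace_apply hz]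
    rfl
  rw [dirDeriv_extChartAt_self, dirDeriv_congr hL, dirDeriv_clm _
    (mdifferentiableAt_extChartAt (mem_chart_source _ w)), dirDeriv_extChartAt_self] at h
  exact h.symm

/-- In chart coordinates the projection is the first component and a vertical lift has the form `(0,
c)`, so the kernel of the projection consists of vertical lifts. -/
theorem exists_vertLift_eq {w : TotalSpace G V} {v : TangentSpace (𝓘(ℝ, EM).prod 𝓘(ℝ, G)) w}
    (hv : mfderiv (𝓘(ℝ, EM).prod 𝓘(ℝ, G)) 𝓘(ℝ, EM) (TotalSpace.proj : TotalSpace G V → M) w v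
      = 0) : ∃ a : V w.proj, vertLift EM w a = v := by
  refine ⟨ofCoord G V w.proj w.proj (v : EM × G).2, ?_⟩
  rw [vertLift_eq, coordAt_ofCoord (mem_baseSet_self w.proj)]
  rw [mfderiv_proj_apply] at hv
  exact Prod.ext hv.symm rfl

end VerticalLift

/-! ### Smooth sections of the prolongation through a given element -/

namespace LieAlgebroid

variable {EM : Type*} [NormedAddCommGroup EM] [NormedSpace ℝ EM] [FiniteDimensional ℝ EM]
  {M : Type*} [TopologicalSpace M] [ChartedSpace EM M] [IsManifold 𝓘(ℝ, EM) ∞ M] [T2Space M]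
  {F : Type*} [NormedAddCommGroup F] [NormedSpace ℝ F] [FiniteDimensional ℝ F]
  {E : M → Type*} [TopologicalSpace (TotalSpace F E)]
  [∀ x, AddCommGroup (E x)] [∀ x, Module ℝ (E x)] [∀ x, TopologicalSpace (E x)]
  [FiberBundle F E] [VectorBundle ℝ F E] [ContMDiffVectorBundle ∞ F E 𝓘(ℝ, EM)]
  {A : LieAlgebroid EM F E}
  {G : Type*} [NormedAddCommGroup G] [NormedSpace ℝ G]
  {V : M → Type*} [TopologicalSpace (TotalSpace G V)]
  [∀ x, AddCommGroup (V x)] [∀ x, Module ℝ (V x)] [∀ x, TopologicalSpace (V x)]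
  [FiberBundle G V] [VectorBundle ℝ G V] [ContMDiffVectorBundle ∞ G V 𝓘(ℝ, EM)]

/-- Every element of the prolongation over a vector bundle is the value of a smooth section whose
`E`-component is constant near the base point. -/
theorem exists_isSmooth_eq {w : TotalSpace G V}
    (a : A.prolFiber (𝓘(ℝ, EM).prod 𝓘(ℝ, G)) (TotalSpace.proj : TotalSpace G V → M) w) :
    ∃ ν : ∀ z, A.prolFiber (𝓘(ℝ, EM).prod 𝓘(ℝ, G)) (TotalSpace.proj : TotalSpace G V → M) z,
      A.IsSmooth ν ∧ ν w = a ∧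
      ∀ᶠ z in 𝓝 w, coordAt F w.proj (ν z).1.1 = coordAt F w.proj a.1.1 := by
  have : IsManifold 𝓘(ℝ, EM) 1 M := .of_le (n := ∞) (by simp)
  have : IsManifold (𝓘(ℝ, EM).prod 𝓘(ℝ, G)) 1 (TotalSpace G V) :=
    .of_le (n := ∞) (by simp)
  have : IsManifold (𝓘(ℝ, EM).prod 𝓘(ℝ, G)) (∞ + 1) (TotalSpace G V) :=
    inferInstanceAs (IsManifold (𝓘(ℝ, EM).prod 𝓘(ℝ, G)) ∞ (TotalSpace G V))
  have hpc : Continuous (TotalSpace.proj : TotalSpace G V → M) := FiberBundle.continuous_proj G V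
  let x := w.proj
  let S : Set (TotalSpace G V) := (chartAt (ModelProd EM G) w).source ∩
    TotalSpace.proj ⁻¹' (trivializationAt F E x).baseSet
  have hSo : IsOpen S := (chartAt (ModelProd EM G) w).open_source.inter
    ((trivializationAt F E x).open_baseSet.preimage hpc)
  let B : Set M := ((chartAt EM x).source ∩ (trivializationAt G V x).baseSet) ∩
    (trivializationAt F E x).baseSet
  have hSB : ∀ z : TotalSpace G V, z ∈ S ↔ z.proj ∈ B := fun z ↦ by
    simp only [S, B, Set.mem_inter_iff, Set.mem_preimage, mem_chart_source_totalSpace_iff]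
    rfl
  have hB : B ∈ 𝓝 x := (((chartAt EM x).open_source.inter
    (trivializationAt G V x).open_baseSet).inter (trivializationAt F E x).open_baseSet).mem_nhds
      ⟨⟨mem_chart_source EM x, mem_baseSet_self x⟩, mem_baseSet_self x⟩
  obtain ⟨f, hf, hfB, hf1⟩ := exists_contMDiff_cutoff (EM := EM) hB
  let c : F := coordAt F x a.1.1
  let b : G := (a.1.2 : EM × G).2
  let u : ∀ z : TotalSpace G V, E z.proj := fun z ↦ ofCoord F E x z.proj c
  let e := trivializationAt (EM × G)
    (TangentSpace (𝓘(ℝ, EM).prod 𝓘(ℝ, G)) : TotalSpace G V → Type _) w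
  -- The base part is forced by the anchor of the constant-coordinate section `u`; the fibre part is
  -- kept constant, equal to that of `a`.
  let v : ∀ z : TotalSpace G V, TangentSpace (𝓘(ℝ, EM).prod 𝓘(ℝ, G)) z := fun z ↦
    e.symm z (A.anchorCoord x z.proj c, b)
  have hvS : ∀ z ∈ S, (e ⟨z, v z⟩).2 = (A.anchorCoord x z.proj c, b) := fun z hz ↦ by
    have : z ∈ e.baseSet := by simpa [e] using hz.1
    simp [v, this]
  have hvd : ∀ z ∈ S, dirDeriv (𝓘(ℝ, EM).prod 𝓘(ℝ, G))
      (extChartAt (𝓘(ℝ, EM).prod 𝓘(ℝ, G)) w) z (v z) = (A.anchorCoord x z.proj c, b) :=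
    fun z hz ↦ (dirDeriv_extChartAt_eq_trivializationAt hz.1 _).trans (hvS z hz)
  have hmem : ∀ z ∈ S, (u z, v z) ∈
      A.prolFiber (𝓘(ℝ, EM).prod 𝓘(ℝ, G)) (TotalSpace.proj : TotalSpace G V → M) z := by
    intro z hz
    have hzB := (hSB z).1 hz
    change A.anchor z.proj (u z) = mfderiv (𝓘(ℝ, EM).prod 𝓘(ℝ, G)) 𝓘(ℝ, EM)
      (TotalSpace.proj : TotalSpace G V → M) z (v z)
    -- The two tangent vectors of `M` are compared after applying the differential of the chart at
    -- `x`, where both become the anchor matrix applied to `c`.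
    have hinj : Function.Injective (mfderiv 𝓘(ℝ, EM) 𝓘(ℝ, EM) (extChartAt 𝓘(ℝ, EM) x) z.proj) :=
      (isInvertible_mfderiv_extChartAt (I := 𝓘(ℝ, EM)) (by simpa using hzB.1.1)).injective
    apply hinj
    have h1 := A.anchorCoord_apply hzB.2 c
    have h2 := dirDeriv_comp (f := extChartAt 𝓘(ℝ, EM) x)
      (p := (TotalSpace.proj : TotalSpace G V → M)) (w := z)
      (mdifferentiableAt_extChartAt hzB.1.1)
      ((contMDiff_proj (n := ∞) V).mdifferentiable (by simp) z) (v z)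
    have hL : (fun z : TotalSpace G V ↦ extChartAt 𝓘(ℝ, EM) x z.proj) =ᶠ[𝓝 z]
        fun z ↦ ContinuousLinearMap.fst ℝ EM G (extChartAt (𝓘(ℝ, EM).prod 𝓘(ℝ, G)) w z) := by
      filter_upwards [hSo.mem_nhds hz] with y hy
      rw [extChartAt_totalSpace_apply ((hSB y).1 hy).1.2]
      rfl
    rw [dirDeriv_congr hL, dirDeriv_clm _ (mdifferentiableAt_extChartAt hz.1), hvd z hz] at h2
    exact h1.symm.trans h2
  classical
  let ν : ∀ z, A.prolFiber (𝓘(ℝ, EM).prod 𝓘(ℝ, G)) (TotalSpace.proj : TotalSpace G V → M) z :=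
    fun z ↦ if h : z ∈ S then f z.proj • ⟨(u z, v z), hmem z h⟩ else 0
  have hν : ∀ z ∈ S, (ν z).1 = (f z.proj • u z, f z.proj • v z) := fun z hz ↦ by
    simp only [ν, dif_pos hz]
    rfl
  have hν0 : ∀ z, z.proj ∉ tsupport f → ν z = 0 := fun z hz ↦ by
    simp only [ν]
    split_ifs
    · rw [image_eq_zero_of_notMem_tsupport hz, zero_smul]
    · rfl
  -- `S` is the full preimage of `B`, so a cutoff on the base supported in `B` suffices, although
  -- its pullback is not compactly supported along the fibres.
  have hcase : ∀ z : TotalSpace G V, z ∈ S ∨ ∀ᶠ y in 𝓝 z, ν y = 0 := fun z ↦ by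
    by_cases hz : z.proj ∈ tsupport f
    · exact .inl ((hSB z).2 (hfB hz))
    · refine .inr ?_
      filter_upwards [((isClosed_tsupport f).isOpen_compl.preimage hpc).mem_nhds hz] with y hy
      exact hν0 y hy
  have hfp : ContMDiff (𝓘(ℝ, EM).prod 𝓘(ℝ, G)) 𝓘(ℝ, ℝ) ∞
    (fun z : TotalSpace G V ↦ f z.proj) := hf.comp (contMDiff_proj V)
  have hwS : w ∈ S := (hSB w).2 (mem_of_mem_nhds hB)
  refine ⟨ν, ⟨fun z ↦ ?_, fun z ↦ ?_⟩, ?_, ?_⟩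
  · rcases hcase z with hz | hz
    · refine contMDiffAt_of_coordAt hz.2 (contMDiff_proj V).contMDiffAt ?_
      refine (hfp.contMDiffAt.smul (contMDiffAt_const (c := c))).congr_of_eventuallyEq ?_
      filter_upwards [hSo.mem_nhds hz] with y hy
      rw [hν y hy, coordAt_smul hy.2, coordAt_ofCoord hy.2]
      rfl
    · refine contMDiffAt_of_coordAt (mem_baseSet_self z.proj) (contMDiff_proj V).contMDiffAt ?_
      refine (contMDiffAt_const (c := (0 : F))).congr_of_eventuallyEq ?_
      filter_upwards [hz, hpc.continuousAt.eventually
        (eventually_mem_baseSet (F := F) (E := E) z.proj)] with y hy hyb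
      rw [hy]
      exact coordAt_zero hyb
  · rcases hcase z with hz | hz
    · have hze : ∀ y ∈ S, y ∈ e.baseSet := fun y hy ↦ by simpa [e] using hy.1
      refine (e.contMDiffAt_iff (f := fun y ↦ (⟨y, (ν y).1.2⟩ : TangentBundle _ _))
        (e.mem_source.2 (hze z hz))).2 ⟨contMDiffAt_id, ?_⟩
      have h1 : ContMDiffAt (𝓘(ℝ, EM).prod 𝓘(ℝ, G)) 𝓘(ℝ, EM × G) ∞
          (fun y : TotalSpace G V ↦ f y.proj • (A.anchorCoord x y.proj c, b)) z := by
        refine hfp.contMDiffAt.smul (ContMDiffAt.prodMk_space ?_ contMDiffAt_const)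
        have hA : ContMDiffAt (𝓘(ℝ, EM).prod 𝓘(ℝ, G)) 𝓘(ℝ, F →L[ℝ] EM) ∞
            (fun y : TotalSpace G V ↦ A.anchorCoord x y.proj) z :=
          ContMDiffAt.comp (g := A.anchorCoord x) z
            (A.contMDiffAt_anchorCoord_of_mem hz.2 ((hSB z).1 hz).1.1)
            (contMDiff_proj V).contMDiffAt
        exact hA.clm_apply contMDiffAt_const
      refine h1.congr_of_eventuallyEq ?_
      filter_upwards [hSo.mem_nhds hz] with y hy
      rw [hν y hy, ← hvS y hy]
      exact (e.linear ℝ (hze y hy)).map_smul _ _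
    · refine contMDiffAt_tangentBundle_of_dirDeriv_extChartAt ?_
      refine (contMDiffAt_const (c := (0 : EM × G))).congr_of_eventuallyEq ?_
      filter_upwards [hz] with y hy
      rw [hy]
      exact dirDeriv_vec_zero _ _
  · apply Subtype.ext
    have hf1' : f w.proj = 1 := hf1.eq_of_nhds
    rw [hν w hwS, hf1', one_smul, one_smul]
    refine Prod.ext (ofCoord_coordAt (mem_baseSet_self x) _) ?_
    have h1 := hvd w hwS
    rw [dirDeriv_extChartAt_self] at h1
    refine h1.trans (Prod.ext ?_ rfl)
    have h2 := anchor_fst a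
    rw [mfderiv_proj_apply, anchor_eq_anchorCoord] at h2
    exact h2
  · filter_upwards [hSo.mem_nhds hwS, hpc.continuousAt.eventually hf1] with z hz hfz
    have hf1' : f z.proj = 1 := hfz
    rw [hν z hz, hf1', one_smul]
    exact coordAt_ofCoord hz.2 _

end LieAlgebroid

end

section

variable {EM : Type*} [NormedAddCommGroup EM] [NormedSpace ℝ EM] [FiniteDimensional ℝ EM]
  {M : Type*} [TopologicalSpace M] [ChartedSpace EM M] [IsManifold 𝓘(ℝ, EM) ∞ M] [T2Space M]
  {F : Type*} [NormedAddCommGroup F] [NormedSpace ℝ F] [FiniteDimensional ℝ F]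
  {E : M → Type*} [TopologicalSpace (TotalSpace F E)]
  [∀ x, AddCommGroup (E x)] [∀ x, Module ℝ (E x)] [∀ x, TopologicalSpace (E x)]
  [FiberBundle F E] [VectorBundle ℝ F E] [ContMDiffVectorBundle ∞ F E 𝓘(ℝ, EM)]

/-- A vertical lift, applied to the fibre coordinates. -/
theorem dirDeriv_coordAt_vertLift {G : Type*} [NormedAddCommGroup G] [NormedSpace ℝ G]
    {V : M → Type*} [TopologicalSpace (TotalSpace G V)]
    [∀ x, AddCommGroup (V x)] [∀ x, Module ℝ (V x)] [∀ x, TopologicalSpace (V x)]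
    [FiberBundle G V] [VectorBundle ℝ G V] [ContMDiffVectorBundle ∞ G V 𝓘(ℝ, EM)]
    (w : TotalSpace G V) (a : V w.proj) :
    dirDeriv (𝓘(ℝ, EM).prod 𝓘(ℝ, G)) (fun z : TotalSpace G V ↦ coordAt G w.proj z.2) w
      (vertLift EM w a) = coordAt G w.proj a := by
  have hm : ContMDiffAt (𝓘(ℝ, EM).prod 𝓘(ℝ, G)) 𝓘(ℝ, G) ∞
      (fun z : TotalSpace G V ↦ coordAt G w.proj z.2) w :=
    contMDiffAt_coordAt (p := fun z : TotalSpace G V ↦ z.proj)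
      (mem_baseSet_self w.proj) contMDiffAt_id
  refine (hasDerivAt_dirDeriv_vertLift (hm.mdifferentiableAt (by simp)) a).unique ?_
  have : (fun t : ℝ ↦ coordAt G w.proj (fiberLine w a t).2) =
      fun t : ℝ ↦ coordAt G w.proj w.2 + t • coordAt G w.proj a :=
    funext fun t ↦ coordAt_add_smul (mem_baseSet_self w.proj) _ _ t
  rw [this]
  simpa using ((hasDerivAt_id (0 : ℝ)).smul_const _).const_add (coordAt G w.proj w.2)

/-! ### Pairings, vertical sections and the canonical symplectic section -/

section Dual

theorem dual_coordAt_apply {x₀ x : M} (hx : x ∈ (trivializationAt F E x₀).baseSet)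
    (α : E x →L[ℝ] Bundle.Trivial M ℝ x) (c : F) :
    coordAt (E := fun x ↦ E x →L[ℝ] Bundle.Trivial M ℝ x) (F →L[ℝ] ℝ) x₀ α c =
      α (ofCoord F E x₀ x c) := by
  unfold coordAt
  rw [hom_trivializationAt_apply]
  simp [ContinuousLinearMap.inCoordinates, ofCoord, Trivialization.symmL_apply _ hx]

/-- Continuous functionals separate the points of the fibres. -/
theorem eq_of_forall_dual_eq {x : M} (hx : x ∈ (trivializationAt F E x).baseSet) {u v : E x}
    (h : ∀ α : E x →L[ℝ] ℝ, α u = α v) : u = v := by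
  apply coordAt_injective hx
  refine (SeparatingDual.eq_iff_forall_dual_eq (R := ℝ)).2 fun f ↦ ?_
  have := h (f.comp ((trivializationAt F E x).continuousLinearMapAt ℝ x))
  simpa [coordAt, Trivialization.linearMapAt_apply, hx] using this

end Dual

namespace LieAlgebroid

section Generic

variable {A : LieAlgebroid EM F E}
  {EP : Type*} [NormedAddCommGroup EP] [NormedSpace ℝ EP] [CompleteSpace EP]
  {HP : Type*} [TopologicalSpace HP] {IP : ModelWithCorners ℝ EP HP} [IP.Boundaryless]
  {P : Type*} [TopologicalSpace P] [ChartedSpace HP P] [IsManifold IP ∞ P]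
  {p : P → M}

theorem IsSmooth.sub {ρ ν : ∀ w, A.prolFiber IP p w} (hρ : A.IsSmooth ρ) (hν : A.IsSmooth ν)
    (hp : ContMDiff IP 𝓘(ℝ, EM) ∞ p) : A.IsSmooth (fun w ↦ ρ w - ν w) where
  fst w := by
    have hw := mem_baseSet_self (F := F) (E := E) (p w)
    refine contMDiffAt_of_coordAt hw hp.contMDiffAt ?_
    refine ((hρ.coord hw).sub (hν.coord hw)).congr_of_eventuallyEq ?_
    filter_upwards [hp.continuous.continuousAt.eventually
      (eventually_mem_baseSet (F := F) (E := E) (p w))] with z hz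
    change coordAt F (p w) ((ρ z).1.1 - (ν z).1.1) = _
    rw [sub_eq_add_neg, coordAt_add hz, coordAt_neg hz, ← sub_eq_add_neg]
  snd := hρ.snd.sub_section hν.snd

/-- When one argument is vertical, the structure functions drop out and only the derivative of the
other argument's coordinates survives. All later brackets with `𝒥 ν` use this. -/
theorem bracketFst_of_fst_eq_zero {ρ ν : ∀ w, A.prolFiber IP p w}
    (hp : ContMDiff IP 𝓘(ℝ, EM) ∞ p) (hν : ∀ w, (ν w).1.1 = 0) (w : P) :
    A.bracketFst ρ ν w = -ofCoord F E (p w) (p w)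
      (dirDeriv IP (fun z ↦ coordAt F (p w) (ρ z).1.1) w (ν w).1.2) := by
  have hw := mem_baseSet_self (F := F) (E := E) (p w)
  have h0 : (fun z ↦ coordAt F (p w) (ν z).1.1) =ᶠ[𝓝 w] fun _ ↦ (0 : F) := by
    filter_upwards [hp.continuous.continuousAt.eventually
      (eventually_mem_baseSet (F := F) (E := E) (p w))] with z hz
    rw [hν, coordAt_zero hz]
  rw [bracketFst_eq, dirDeriv_congr h0, dirDeriv_const, hν, map_zero, add_zero, zero_sub,
    ← neg_one_smul ℝ, ofCoord_smul hw, neg_one_smul]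

theorem bracketFst_of_fst_eq_zero_left {ρ ν : ∀ w, A.prolFiber IP p w}
    (hp : ContMDiff IP 𝓘(ℝ, EM) ∞ p) (hρ : ∀ w, (ρ w).1.1 = 0) (w : P) :
    A.bracketFst ρ ν w = ofCoord F E (p w) (p w)
      (dirDeriv IP (fun z ↦ coordAt F (p w) (ν z).1.1) w (ρ w).1.2) := by
  have h0 : (fun z ↦ coordAt F (p w) (ρ z).1.1) =ᶠ[𝓝 w] fun _ ↦ (0 : F) := by
    filter_upwards [hp.continuous.continuousAt.eventually
      (eventually_mem_baseSet (F := F) (E := E) (p w))] with z hz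
    rw [hρ, coordAt_zero hz]
  rw [bracketFst_eq, dirDeriv_congr h0, dirDeriv_const, hρ, map_zero, LinearMap.zero_apply,
    add_zero, sub_zero]

end Generic

variable (A : LieAlgebroid EM F E)

theorem exists_vertDual_eq {μ : DualTotal F E} {a : A.TEdual μ} (ha : a.1.1 = 0) :
    ∃ α : E μ.proj →L[ℝ] ℝ, A.vertDual μ α = a := by
  have h := anchor_fst a
  rw [ha, map_zero] at h
  obtain ⟨α, hα⟩ := exists_vertLift_eq h.symm
  exact ⟨α, Subtype.ext (Prod.ext ha.symm hα)⟩

theorem isChartLinear_dual : IsChartLinear (EM := EM) (𝓘(ℝ, EM).prod 𝓘(ℝ, F →L[ℝ] ℝ))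
    (TotalSpace.proj : DualTotal F E → M) :=
  isChartLinear_proj _

/-- The Liouville section vanishes on `ν'`. Deriving $\theta_E(\nu)=\mu(\nu_E)$ along $\alpha^v$
gives $\alpha(\nu_E)$ plus $\mu$ applied to the derivative of $\nu_E$, and the second term cancels
against $\theta_E([\nu',\nu])$. -/
theorem omega_vertDual {ν' ν : ∀ μ, A.TEdual μ} (hν' : A.IsSmooth ν') (hν : A.IsSmooth ν)
    (hv : ∀ μ, (ν' μ).1.1 = 0) {μ : DualTotal F E} {α : E μ.proj →L[ℝ] ℝ}
    (hα : ν' μ = A.vertDual μ α) : A.omega ν' ν μ = -α (ν μ).1.1 := by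
  have hx := mem_baseSet_self (F := F) (E := E) μ.proj
  have hpc : Continuous (TotalSpace.proj : DualTotal F E → M) :=
    FiberBundle.continuous_proj _ _
  let m : DualTotal F E → F →L[ℝ] ℝ := fun z ↦
    coordAt (E := fun x ↦ E x →L[ℝ] Bundle.Trivial M ℝ x) (F →L[ℝ] ℝ) μ.proj z.2
  have hm : ContMDiffAt (𝓘(ℝ, EM).prod 𝓘(ℝ, F →L[ℝ] ℝ)) 𝓘(ℝ, F →L[ℝ] ℝ) ∞ m μ :=
    contMDiffAt_coordAt (p := fun z : DualTotal F E ↦ z.proj)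
      (E := fun x ↦ E x →L[ℝ] Bundle.Trivial M ℝ x) (mem_baseSet_self μ.proj) contMDiffAt_id
  have hmd : dirDeriv (𝓘(ℝ, EM).prod 𝓘(ℝ, F →L[ℝ] ℝ)) m μ (vertLift EM μ α) =
      coordAt (E := fun x ↦ E x →L[ℝ] Bundle.Trivial M ℝ x) (F →L[ℝ] ℝ) μ.proj α :=
    dirDeriv_coordAt_vertLift μ α
  have h1 : (fun z ↦ A.liouville z (ν z)) =ᶠ[𝓝 μ]
      fun z ↦ m z (coordAt F μ.proj (ν z).1.1) := by
    filter_upwards [hpc.continuousAt.eventually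
      (eventually_mem_baseSet (F := F) (E := E) μ.proj)] with z hz
    refine Eq.trans ?_ (dual_coordAt_apply hz z.2 (coordAt F μ.proj (ν z).1.1)).symm
    rw [ofCoord_coordAt hz]
    rfl
  have h2 : (fun z ↦ A.liouville z (ν' z)) = fun _ ↦ (0 : ℝ) := funext fun z ↦ by
    change z.2 _ = (0 : ℝ)
    rw [hv]
    exact map_zero z.2
  have h3 : A.liouville μ (A.prolBracket ν' ν μ) = m μ (dirDeriv (𝓘(ℝ, EM).prod 𝓘(ℝ, F →L[ℝ] ℝ))
      (fun z ↦ coordAt F μ.proj (ν z).1.1) μ (vertLift EM μ α)) := by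
    refine Eq.trans ?_ (dual_coordAt_apply hx μ.2 _).symm
    rw [liouville, hν'.prolBracket_coe hν isChartLinear_dual, bracketFst_of_fst_eq_zero_left
      isChartLinear_dual.contMDiff hv, hα]
    rfl
  rw [omega, dirDeriv_congr h1, h2, dirDeriv_const, h3, hα]
  have h4 : (A.vertDual μ α).1.2 = vertLift EM μ α := rfl
  rw [h4, dirDeriv_clm_apply (hm.mdifferentiableAt (by simp))
    ((hν.coord hx).mdifferentiableAt (by simp)), hmd, dual_coordAt_apply hx, ofCoord_coordAt hx]
  ring

end LieAlgebroid

/-! ### The induced almost tangent structure and regularity -/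

namespace HyperregularHamiltonian

variable {A : LieAlgebroid EM F E} (h : HyperregularHamiltonian EM F E)

theorem contMDiff_Φ :
    ContMDiff (𝓘(ℝ, EM).prod 𝓘(ℝ, F →L[ℝ] ℝ)) (𝓘(ℝ, EM).prod 𝓘(ℝ, F)) ∞ h.Φ := by
  rw [Φ_eq_legendre]
  exact h.legendre.contMDiff

theorem contMDiffAt_coordAt_fiberDeriv (μ : DualTotal F E) :
    ContMDiffAt (𝓘(ℝ, EM).prod 𝓘(ℝ, F →L[ℝ] ℝ)) 𝓘(ℝ, F) ∞
      (fun z ↦ coordAt F μ.proj (h.fiberDeriv z)) μ :=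
  contMDiffAt_coordAt (p := fun z : DualTotal F E ↦ z.proj) (mem_baseSet_self μ.proj)
    h.contMDiff_Φ.contMDiffAt

/-- The derivative of the fibre derivative along the fibre. -/
def vertDeriv (μ : DualTotal F E) (α : E μ.proj →L[ℝ] ℝ) : E μ.proj :=
  ofCoord F E μ.proj μ.proj (dirDeriv (𝓘(ℝ, EM).prod 𝓘(ℝ, F →L[ℝ] ℝ))
    (fun z ↦ coordAt F μ.proj (h.fiberDeriv z)) μ (vertLift EM μ α))

/-- The inner derivative is $\beta$ applied to $\Phi$ along the line $\mu+r\alpha$; since $\beta$ is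
a fixed linear functional, the outer derivative falls on $\Phi$ alone. -/
theorem fiberHessian_eq (μ : DualTotal F E) (α β : E μ.proj →L[ℝ] ℝ) :
    fiberHessian h.H μ α β = β (h.vertDeriv μ α) := by
  have hx := mem_baseSet_self (F := F) (E := E) μ.proj
  have h1 : (fun r : ℝ ↦ deriv (fun t : ℝ ↦ h.H ⟨μ.proj, μ.2 + r • α + t • β⟩) 0) =
      fun r : ℝ ↦ β.comp ((trivializationAt F E μ.proj).symmL ℝ μ.proj)
        (coordAt F μ.proj (h.fiberDeriv (fiberLine μ α r))) := by
    funext r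
    rw [ContinuousLinearMap.comp_apply, Trivialization.symmL_apply _ hx]
    have h2 : (trivializationAt F E μ.proj).symm μ.proj
        (coordAt F μ.proj (h.fiberDeriv (fiberLine μ α r))) = h.fiberDeriv (fiberLine μ α r) :=
      ofCoord_coordAt hx _
    rw [h2]
    exact (h.hasDerivAt (fiberLine μ α r) β).deriv
  rw [fiberHessian, h1]
  have h3 := hasDerivAt_dirDeriv_vertLift (EM := EM)
    ((h.contMDiffAt_coordAt_fiberDeriv μ).mdifferentiableAt (by simp)) α
  refine (((β.comp ((trivializationAt F E μ.proj).symmL ℝ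
    μ.proj)).hasFDerivAt.comp_hasDerivAt (0 : ℝ) h3).deriv).trans ?_
  rw [ContinuousLinearMap.comp_apply, Trivialization.symmL_apply _ hx]
  rfl

variable {h} {𝒥 : ∀ μ, A.TEdual μ →ₗ[ℝ] A.TEdual μ} (h𝒥 : h.IsInducedStructure A 𝒥)
include h𝒥

namespace IsInducedStructure

theorem fst_eq_zero (μ : DualTotal F E) (a : A.TEdual μ) : (𝒥 μ a).1.1 = 0 :=
  (h𝒥.adapted.range μ _).1 ⟨a, rfl⟩

theorem apply_eq_of_fst_eq {μ : DualTotal F E} {a b : A.TEdual μ} (hab : a.1.1 = b.1.1) :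
    𝒥 μ a = 𝒥 μ b := by
  rw [← sub_eq_zero, ← map_sub]
  refine (h𝒥.adapted.ker μ (a - b)).2 ?_
  change a.1.1 - b.1.1 = 0
  rw [hab, sub_self]

/-- `𝒥` is the inverse of the fibre derivative of the Legendre map. -/
theorem fst_eq_vertDeriv {μ : DualTotal F E} {a : A.TEdual μ} {β : E μ.proj →L[ℝ] ℝ}
    (ha : 𝒥 μ a = A.vertDual μ β) : a.1.1 = h.vertDeriv μ β := by
  refine eq_of_forall_dual_eq (mem_baseSet_self (F := F) _) fun α ↦ ?_
  obtain ⟨b, hb⟩ := (h𝒥.adapted.range μ (A.vertDual μ α)).2 rfl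
  obtain ⟨ν, hν, hνa, -⟩ := LieAlgebroid.exists_isSmooth_eq a
  obtain ⟨ρ, hρ, hρb, -⟩ := LieAlgebroid.exists_isSmooth_eq b
  have h1 := h𝒥.metric ν ρ hν hρ μ β α (by rw [hνa, ha]) (by rw [hρb, hb])
  -- Symmetry moves `𝒥` onto `ρ`, whose image at `μ` is the test vector $\alpha^v$. Then $\omega_E$
  -- reads off $\alpha(a_E)$, to be compared with the Hessian $\alpha(D_\beta\Phi)$.
  rw [h𝒥.symm ν ρ hν hρ, A.omega_vertDual (h𝒥.adapted.smooth ρ hρ) hν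
    (fun z ↦ h𝒥.fst_eq_zero z _) (α := α) (by rw [hρb, hb]), fiberHessian_eq, hνa, neg_neg] at h1
  exact h1.symm

theorem exists_apply_eq (μ : DualTotal F E) (a : A.TEdual μ) :
    ∃ β : E μ.proj →L[ℝ] ℝ, 𝒥 μ a = A.vertDual μ β ∧ a.1.1 = h.vertDeriv μ β := by
  obtain ⟨β, hβ⟩ := A.exists_vertDual_eq (h𝒥.fst_eq_zero μ a)
  exact ⟨β, hβ.symm, h𝒥.fst_eq_vertDeriv hβ.symm⟩

/-- Writing $\mathcal J\nu=\beta^v$ at $\mu$, the bracket contributes $-D_\beta\Phi$, because the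
$E$-component of $\rho$ is $\Phi$; and $D_\beta\Phi$ is the $E$-component of $\nu$ at $\mu$ by the
description of $\mathcal J$. -/
theorem prolBracket_fst {ρ : ∀ μ, A.TEdual μ} (hρ : h.IsInducedSection A ρ)
    {ν : ∀ μ, A.TEdual μ} (hν : A.IsSmooth ν) (μ : DualTotal F E) :
    (A.prolBracket ρ (fun z ↦ 𝒥 z (ν z)) μ).1.1 = -(ν μ).1.1 := by
  obtain ⟨β, hβ, hνβ⟩ := h𝒥.exists_apply_eq μ (ν μ)
  rw [hρ.smooth.prolBracket_coe (h𝒥.adapted.smooth ν hν) LieAlgebroid.isChartLinear_dual,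
    LieAlgebroid.bracketFst_of_fst_eq_zero LieAlgebroid.isChartLinear_dual.contMDiff
      (fun z ↦ h𝒥.fst_eq_zero z _), hνβ, hβ]
  simp only [hρ.fst_eq]
  rfl

theorem isRegular {ρ : ∀ μ, A.TEdual μ} (hρ : h.IsInducedSection A ρ) : A.IsRegular 𝒥 ρ := by
  intro ν hν μ
  rw [← map_neg]
  exact h𝒥.apply_eq_of_fst_eq (h𝒥.prolBracket_fst hρ hν μ)

end IsInducedStructure

end HyperregularHamiltonian

end

section

variable {EM : Type*} [NormedAddCommGroup EM] [NormedSpace ℝ EM] [FiniteDimensional ℝ EM]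
  {M : Type*} [TopologicalSpace M] [ChartedSpace EM M] [IsManifold 𝓘(ℝ, EM) ∞ M] [T2Space M]
  {F : Type*} [NormedAddCommGroup F] [NormedSpace ℝ F] [FiniteDimensional ℝ F]
  {E : M → Type*} [TopologicalSpace (TotalSpace F E)]
  [∀ x, AddCommGroup (E x)] [∀ x, Module ℝ (E x)] [∀ x, TopologicalSpace (E x)]
  [FiberBundle F E] [VectorBundle ℝ F E] [ContMDiffVectorBundle ∞ F E 𝓘(ℝ, EM)]

/-! ### The Lie derivative as a connection on the prolongation over the dual -/

namespace HyperregularHamiltonian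

variable {A : LieAlgebroid EM F E} {h : HyperregularHamiltonian EM F E}
  {𝒥 : ∀ μ, A.TEdual μ →ₗ[ℝ] A.TEdual μ} 

namespace IsInducedStructure

/-- In the chart at `μ`, the almost tangent structure is a smooth family of linear maps of the
`E`-component. -/
theorem exists_coord (h𝒥 : h.IsInducedStructure A 𝒥) (μ : DualTotal F E) :
    ∃ K : DualTotal F E → F →L[ℝ] EM × (F →L[ℝ] ℝ),
      ContMDiffAt (𝓘(ℝ, EM).prod 𝓘(ℝ, F →L[ℝ] ℝ)) 𝓘(ℝ, F →L[ℝ] EM × (F →L[ℝ] ℝ)) ∞ K μ ∧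
      ∀ᶠ z in 𝓝 μ, ∀ a : A.TEdual z,
        dirDeriv (𝓘(ℝ, EM).prod 𝓘(ℝ, F →L[ℝ] ℝ))
          (extChartAt (𝓘(ℝ, EM).prod 𝓘(ℝ, F →L[ℝ] ℝ)) μ) z (𝒥 z a).1.2 =
        K z (coordAt F μ.proj a.1.1) := by
  let b := Module.finBasis ℝ F
  have hx := mem_baseSet_self (F := F) (E := E) μ.proj
  have hpc : Continuous (TotalSpace.proj : DualTotal F E → M) :=
    FiberBundle.continuous_proj _ _
  have hsurj : ∀ c : F, ∃ a : A.TEdual μ, coordAt F μ.proj a.1.1 = c := by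
    intro c
    obtain ⟨v, hv⟩ : ∃ v : TangentSpace (𝓘(ℝ, EM).prod 𝓘(ℝ, F →L[ℝ] ℝ)) μ,
        mfderiv (𝓘(ℝ, EM).prod 𝓘(ℝ, F →L[ℝ] ℝ)) 𝓘(ℝ, EM)
          (TotalSpace.proj : DualTotal F E → M) μ v = A.anchor μ.proj (ofCoord F E μ.proj μ.proj c) :=
      -- The base part is dictated by the anchor; the fibre part is arbitrary, since `𝒥` ignores it.
      ⟨((A.anchor μ.proj (ofCoord F E μ.proj μ.proj c) : EM), (0 : F →L[ℝ] ℝ)),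
        mfderiv_proj_apply _ _⟩
    exact ⟨⟨(ofCoord F E μ.proj μ.proj c, v), hv.symm⟩, coordAt_ofCoord hx c⟩
  choose a ha using hsurj
  choose ν hν hνa hνc using fun c ↦ LieAlgebroid.exists_isSmooth_eq (a c)
  let k : Fin (Module.finrank ℝ F) → DualTotal F E → EM × (F →L[ℝ] ℝ) := fun i z ↦
    dirDeriv (𝓘(ℝ, EM).prod 𝓘(ℝ, F →L[ℝ] ℝ))
      (extChartAt (𝓘(ℝ, EM).prod 𝓘(ℝ, F →L[ℝ] ℝ)) μ) z (𝒥 z (ν (b i) z)).1.2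
  let K : DualTotal F E → F →L[ℝ] EM × (F →L[ℝ] ℝ) := fun z ↦
    ∑ i, ((LinearMap.toContinuousLinearMap (b.coord i)).smulRight (k i z))
  have hK : ∀ z c, K z c = ∑ i, b.coord i c • k i z := fun z c ↦ by
    simp [K]
  refine ⟨K, contMDiffAt_clm_of_apply fun c ↦ ?_, ?_⟩
  · simp only [hK]
    refine contMDiffAt_finsetSum fun i _ ↦ ContMDiffAt.smul (f := fun _ ↦ b.coord i c) (g := k i)
      (contMDiffAt_const (I' := 𝓘(ℝ, ℝ))) ?_
    exact ContMDiffAt.dirDeriv_extChartAt (h𝒥.adapted.smooth _ (hν (b i))).snd.contMDiffAt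
  · filter_upwards [hpc.continuousAt.eventually (eventually_mem_baseSet (F := F) (E := E) μ.proj),
      eventually_all.2 fun i ↦ hνc (b i)] with z hz hzc d
    have h1 : 𝒥 z d = 𝒥 z (∑ i, b.coord i (coordAt F μ.proj d.1.1) • ν (b i) z) := by
      refine h𝒥.apply_eq_of_fst_eq (coordAt_injective hz ?_)
      have h2 : (∑ i, b.coord i (coordAt F μ.proj d.1.1) • ν (b i) z : A.TEdual z).1.1 =
          ∑ i, b.coord i (coordAt F μ.proj d.1.1) • (ν (b i) z).1.1 := by
        simp [Prod.fst_sum]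
      rw [h2, coordAt_sum hz]
      simp only [coordAt_smul hz, hzc, ha]
      exact (b.sum_repr _).symm
    rw [h1, hK]
    let T : A.TEdual z →ₗ[ℝ] EM × (F →L[ℝ] ℝ) :=
      { toFun := fun d ↦ dirDeriv (𝓘(ℝ, EM).prod 𝓘(ℝ, F →L[ℝ] ℝ))
          (extChartAt (𝓘(ℝ, EM).prod 𝓘(ℝ, F →L[ℝ] ℝ)) μ) z (𝒥 z d).1.2
        map_add' := fun d e ↦ by rw [map_add]; exact dirDeriv_vec_add _ _ _ _
        map_smul' := fun r d ↦ by rw [map_smul]; exact dirDeriv_vec_smul _ _ _ _ }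
    exact (map_sum T _ _).trans (Finset.sum_congr rfl fun i _ ↦ map_smul T _ _)

variable {ρ : ∀ μ, A.TEdual μ}

theorem lieDerivative_fst (h𝒥 : h.IsInducedStructure A 𝒥) (hρ : h.IsInducedSection A ρ)
    {ν : ∀ μ, A.TEdual μ} (hν : A.IsSmooth ν) (μ : DualTotal F E) :
    (A.lieDerivative ρ (fun z ↦ 𝒥 z) ν μ).1.1 = -(ν μ).1.1 := by
  have h1 := h𝒥.prolBracket_fst hρ hν μ
  have h2 := h𝒥.fst_eq_zero μ (A.prolBracket ρ ν μ)
  change _ - _ = _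
  rw [h1, h2, sub_zero]

/-- Tensoriality of the Lie derivative. With `𝒥` given in the chart by a matrix `K`, both
$[\rho,\mathcal J\nu]$ and $\mathcal J[\rho,\nu]$ contain `K` applied to the derivative of the
coordinates of $\nu$ along $\rho$. These terms cancel, and the rest involves only the value of $\nu$
at $\mu$. -/
theorem exists_lieDerivative_snd (h𝒥 : h.IsInducedStructure A 𝒥) (hρ : h.IsInducedSection A ρ)
    (μ : DualTotal F E) : ∃ g : A.TEdual μ →ₗ[ℝ] EM × (F →L[ℝ] ℝ),
      ∀ ν : ∀ μ, A.TEdual μ, A.IsSmooth ν →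
        (A.lieDerivative ρ (fun z ↦ 𝒥 z) ν μ).1.2 = g (ν μ) := by
  obtain ⟨K, hK, hK𝒥⟩ := h𝒥.exists_coord μ
  have hx := mem_baseSet_self (F := F) (E := E) μ.proj
  let IP := 𝓘(ℝ, EM).prod 𝓘(ℝ, F →L[ℝ] ℝ)
  let U : DualTotal F E → EM × (F →L[ℝ] ℝ) := fun z ↦
    dirDeriv IP (extChartAt IP μ) z (ρ z).1.2
  let X : DualTotal F E → F := fun z ↦ coordAt F μ.proj (ρ z).1.1
  let D₁ : TangentSpace IP μ →ₗ[ℝ] F :=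
    ⟨⟨dirDeriv IP X μ, dirDeriv_vec_add X μ⟩, dirDeriv_vec_smul X μ⟩
  let D₂ : TangentSpace IP μ →ₗ[ℝ] EM × (F →L[ℝ] ℝ) :=
    ⟨⟨dirDeriv IP U μ, dirDeriv_vec_add U μ⟩, dirDeriv_vec_smul U μ⟩
  let c : E μ.proj →ₗ[ℝ] F :=
    ⟨⟨coordAt F μ.proj, coordAt_add hx⟩, coordAt_smul hx⟩
  let π₁ : A.TEdual μ →ₗ[ℝ] E μ.proj := LinearMap.fst ℝ _ _ ∘ₗ Submodule.subtype _
  let π₂ : A.TEdual μ →ₗ[ℝ] TangentSpace IP μ := LinearMap.snd ℝ _ _ ∘ₗ Submodule.subtype _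
  let g : A.TEdual μ →ₗ[ℝ] EM × (F →L[ℝ] ℝ) :=
    (dirDeriv IP K μ (ρ μ).1.2).toLinearMap ∘ₗ c ∘ₗ π₁ - D₂ ∘ₗ π₂ ∘ₗ 𝒥 μ +
      (K μ).toLinearMap ∘ₗ (D₁ ∘ₗ π₂ - c ∘ₗ A.structureMap μ.proj (ρ μ).1.1 ∘ₗ π₁)
  refine ⟨g, fun ν hν ↦ ?_⟩
  have h𝒥ν := h𝒥.adapted.smooth ν hν
  have h1 : (fun z ↦ dirDeriv IP (extChartAt IP μ) z (𝒥 z (ν z)).1.2) =ᶠ[𝓝 μ]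
      fun z ↦ K z (coordAt F μ.proj (ν z).1.1) := hK𝒥.mono fun z hz ↦ hz (ν z)
  have h2 : (A.prolBracket ρ (fun z ↦ 𝒥 z (ν z)) μ).1.2 =
      (dirDeriv IP K μ (ρ μ).1.2 (coordAt F μ.proj (ν μ).1.1) +
        K μ (dirDeriv IP (fun z ↦ coordAt F μ.proj (ν z).1.1) μ (ρ μ).1.2) -
        dirDeriv IP U μ (𝒥 μ (ν μ)).1.2 : EM × (F →L[ℝ] ℝ)) := by
    rw [hρ.smooth.prolBracket_coe h𝒥ν LieAlgebroid.isChartLinear_dual]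
    refine (mlieBracket_eq_dirDeriv_sub hρ.smooth.snd.contMDiffAt h𝒥ν.snd.contMDiffAt).trans ?_
    rw [dirDeriv_congr h1, dirDeriv_clm_apply (hK.mdifferentiableAt (by simp))
      ((hν.coord hx).mdifferentiableAt (by simp))]
  have h3 : (𝒥 μ (A.prolBracket ρ ν μ)).1.2 =
      K μ (coordAt F μ.proj (A.prolBracket ρ ν μ).1.1) :=
    (dirDeriv_extChartAt_self (IP := 𝓘(ℝ, EM).prod 𝓘(ℝ, F →L[ℝ] ℝ)) μ _).symm.trans
      (hK𝒥.self_of_nhds _)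
  have h4 : coordAt F μ.proj (A.prolBracket ρ ν μ).1.1 =
      dirDeriv IP (fun z ↦ coordAt F μ.proj (ν z).1.1) μ (ρ μ).1.2 - dirDeriv IP X μ (ν μ).1.2 +
        coordAt F μ.proj (A.structureMap μ.proj (ρ μ).1.1 (ν μ).1.1) := by
    rw [hρ.smooth.prolBracket_coe hν LieAlgebroid.isChartLinear_dual]
    change coordAt F μ.proj (A.bracketFst ρ ν μ) = _
    rw [LieAlgebroid.bracketFst_eq, coordAt_add hx, coordAt_ofCoord hx]
  have h5 : (A.lieDerivative ρ (fun z ↦ 𝒥 z) ν μ).1.2 =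
      ((A.prolBracket ρ (fun z ↦ 𝒥 z (ν z)) μ).1.2 : EM × (F →L[ℝ] ℝ)) -
        (𝒥 μ (A.prolBracket ρ ν μ)).1.2 := rfl
  have h6 : g (ν μ) = dirDeriv IP K μ (ρ μ).1.2 (coordAt F μ.proj (ν μ).1.1) -
      dirDeriv IP U μ (𝒥 μ (ν μ)).1.2 + K μ (dirDeriv IP X μ (ν μ).1.2 -
        coordAt F μ.proj (A.structureMap μ.proj (ρ μ).1.1 (ν μ).1.1)) := rfl
  rw [h5, h2, h3, h4, h6, map_add, map_sub, map_sub]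
  abel

theorem exists_linear (h𝒥 : h.IsInducedStructure A 𝒥) (hρ : h.IsInducedSection A ρ) :
    ∃ 𝒩 : ∀ μ, A.TEdual μ →ₗ[ℝ] A.TEdual μ,
      ∀ ν : ∀ μ, A.TEdual μ, A.IsSmooth ν → ∀ μ,
        𝒩 μ (ν μ) = -A.lieDerivative ρ (fun z ↦ 𝒥 z) ν μ := by
  choose g hg using h𝒥.exists_lieDerivative_snd hρ
  choose ν hν hνa _ using fun (μ : DualTotal F E) (a : A.TEdual μ) ↦
    LieAlgebroid.exists_isSmooth_eq a
  have key : ∀ (ξ : ∀ μ, A.TEdual μ), A.IsSmooth ξ → ∀ μ,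
      (-A.lieDerivative ρ (fun z ↦ 𝒥 z) ξ μ).1 = ((ξ μ).1.1, -g μ (ξ μ)) := fun ξ hξ μ ↦ by
    refine Prod.ext ?_ ?_
    · exact (congrArg Neg.neg (h𝒥.lieDerivative_fst hρ hξ μ)).trans (neg_neg _)
    · exact congrArg Neg.neg (hg μ ξ hξ)
  -- The value on `a` is computed with a chosen smooth section through `a`; `key` makes the result
  -- independent of that choice and linear in `a`.
  refine ⟨fun μ ↦
    { toFun := fun a ↦ -A.lieDerivative ρ (fun z ↦ 𝒥 z) (ν μ a) μ
      map_add' := fun a b ↦ ?_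
      map_smul' := fun r a ↦ ?_ }, fun ξ hξ μ ↦ ?_⟩
  · refine Subtype.ext ?_
    rw [Submodule.coe_add, key _ (hν _ _), key _ (hν _ _), key _ (hν _ _), hνa, hνa, hνa, map_add,
      neg_add]
    rfl
  · refine Subtype.ext ?_
    rw [RingHom.id_apply, Submodule.coe_smul, key _ (hν _ _), key _ (hν _ _), hνa, hνa, map_smul]
    exact Prod.ext rfl (smul_neg r (g μ a)).symm
  · refine Subtype.ext ?_
    refine (key _ (hν _ _) _).trans (Eq.trans ?_ (key _ hξ _).symm)
    rw [hνa]

theorem isConnection (h𝒥 : h.IsInducedStructure A 𝒥) (hρ : h.IsInducedSection A ρ)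
    {𝒩 : ∀ μ, A.TEdual μ →ₗ[ℝ] A.TEdual μ}
    (h𝒩 : ∀ ν : ∀ μ, A.TEdual μ, A.IsSmooth ν → ∀ μ,
      𝒩 μ (ν μ) = -A.lieDerivative ρ (fun z ↦ 𝒥 z) ν μ) : A.IsConnection 𝒩 := by
  have hfst : ∀ μ (a : A.TEdual μ), (𝒩 μ a).1.1 = a.1.1 := fun μ a ↦ by
    obtain ⟨ν, hν, rfl, -⟩ := LieAlgebroid.exists_isSmooth_eq a
    rw [h𝒩 ν hν]
    exact (congrArg Neg.neg (h𝒥.lieDerivative_fst hρ hν μ)).trans (neg_neg _)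
  have hvert : ∀ μ (a : A.TEdual μ), a.1.1 = 0 → 𝒩 μ a = -a := fun μ a ha ↦ by
    -- Write the vertical element as $\mathcal J\eta$. Then $(\mathcal L_\rho\mathcal J)(\mathcal
    -- J\eta)=[\rho,\mathcal J^2\eta]-\mathcal J[\rho,\mathcal J\eta]=\mathcal J\eta$.
    obtain ⟨b, rfl⟩ := (h𝒥.adapted.range μ a).2 ha
    obtain ⟨η, hη, rfl, -⟩ := LieAlgebroid.exists_isSmooth_eq b
    have hsq : (fun z ↦ 𝒥 z (𝒥 z (η z))) = fun z ↦ 𝒥 z (0 : A.TEdual z) := funext fun z ↦ by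
      rw [map_zero]
      exact LinearMap.congr_fun (h𝒥.adapted.sq z) (η z)
    have h0 : A.IsSmooth (fun z ↦ (0 : A.TEdual z)) := by
      have := hη.sub hη LieAlgebroid.isChartLinear_dual.contMDiff
      simpa using this
    have h1 := h𝒩 _ (h𝒥.adapted.smooth η hη) μ
    rw [h1, LieAlgebroid.lieDerivative, h𝒥.isRegular hρ η hη, hsq]
    -- The bracket with the zero section vanishes: linearity of `𝒩` gives $[\rho,0]=\mathcal
    -- J[\rho,0]$, and regularity makes the right side zero.
    have h2 : A.prolBracket ρ (fun z ↦ 𝒥 z (0 : A.TEdual z)) μ = 0 := by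
      have hz : (fun z ↦ 𝒥 z (0 : A.TEdual z)) = fun z ↦ 0 := funext fun z ↦ map_zero _
      have h3 := h𝒥.isRegular hρ _ h0 μ
      have h4 := h𝒩 _ h0 μ
      rw [LieAlgebroid.lieDerivative, hz, map_zero] at h4
      rw [hz, map_zero, neg_zero] at h3
      rwa [h3, sub_zero, zero_eq_neg, ← hz] at h4
    rw [h2, zero_sub, neg_neg]
  refine ⟨fun ν hν ↦ ?_, fun μ ↦ ?_, fun μ a ↦ ⟨fun ha ↦ ?_, fun ha ↦ ?_⟩⟩
  · have hp := LieAlgebroid.isChartLinear_dual (EM := EM) (F := F) (E := E)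
    have h1 := (h𝒥.adapted.smooth _ (hρ.smooth.prolBracket hν hp)).sub
      (hρ.smooth.prolBracket (h𝒥.adapted.smooth ν hν) hp) hp.contMDiff
    convert h1 using 2 with μ
    rw [h𝒩 ν hν, LieAlgebroid.lieDerivative, neg_sub]
  · refine LinearMap.ext fun a ↦ ?_
    -- `𝒩` preserves $E$-components, so the difference is vertical, where `𝒩` is $-1$.
    have h1 : 𝒩 μ (𝒩 μ a - a) = -(𝒩 μ a - a) := by
      refine hvert μ _ ?_
      change (𝒩 μ a).1.1 - a.1.1 = 0
      rw [hfst, sub_self]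
    rw [map_sub, neg_sub, sub_left_inj] at h1
    exact h1
  · have h1 : a.1.1 + (𝒩 μ a).1.1 = 0 := congrArg (fun b : A.TEdual μ ↦ b.1.1) ha
    rw [hfst, ← two_smul ℝ, smul_eq_zero] at h1
    exact h1.resolve_left two_ne_zero
  · change a + 𝒩 μ a = 0
    rw [hvert μ a ha, add_neg_cancel]

end IsInducedStructure

end HyperregularHamiltonian

end

section

variable {EM : Type*} [NormedAddCommGroup EM] [NormedSpace ℝ EM] [FiniteDimensional ℝ EM]
  {M : Type*} [TopologicalSpace M] [ChartedSpace EM M] [IsManifold 𝓘(ℝ, EM) ∞ M] [T2Space M]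
  {F : Type*} [NormedAddCommGroup F] [NormedSpace ℝ F] [FiniteDimensional ℝ F]
  {E : M → Type*} [TopologicalSpace (TotalSpace F E)]
  [∀ x, AddCommGroup (E x)] [∀ x, Module ℝ (E x)] [∀ x, TopologicalSpace (E x)]
  [FiberBundle F E] [VectorBundle ℝ F E] [ContMDiffVectorBundle ∞ F E 𝓘(ℝ, EM)]

/-! ### Transfer along the Legendre map -/

namespace HyperregularHamiltonian

variable {A : LieAlgebroid EM F E} (h : HyperregularHamiltonian EM F E)

theorem exists_Φ_eq (w : TotalSpace F E) : ∃ μ, h.Φ μ = w :=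
  ⟨_, h.Φ_legendre_symm w⟩

theorem Φ_injective : Function.Injective h.Φ := by
  rw [Φ_eq_legendre]
  exact h.legendre.injective

theorem legendre_symm_Φ (μ : DualTotal F E) : h.legendre.symm (h.Φ μ) = μ := by
  rw [Φ_eq_legendre, Diffeomorph.symm_apply_apply]

theorem mdifferentiableAt_Φ (μ : DualTotal F E) :
    MDifferentiableAt (𝓘(ℝ, EM).prod 𝓘(ℝ, F →L[ℝ] ℝ)) (𝓘(ℝ, EM).prod 𝓘(ℝ, F)) h.Φ μ :=
  h.contMDiff_Φ.mdifferentiable (by simp) μ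

theorem isInvertible_mfderiv_Φ (μ : DualTotal F E) :
    (mfderiv (𝓘(ℝ, EM).prod 𝓘(ℝ, F →L[ℝ] ℝ)) (𝓘(ℝ, EM).prod 𝓘(ℝ, F)) h.Φ μ).IsInvertible := by
  have h1 := h.legendre.mfderivToContinuousLinearEquiv_coe (by simp) (x := μ)
  have h2 : (mfderiv (𝓘(ℝ, EM).prod 𝓘(ℝ, F →L[ℝ] ℝ)) (𝓘(ℝ, EM).prod 𝓘(ℝ, F))
      h.legendre μ).IsInvertible := ⟨_, h1⟩
  rwa [← Φ_eq_legendre] at h2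

theorem mfderiv_proj_Φ (μ : DualTotal F E)
    (v : TangentSpace (𝓘(ℝ, EM).prod 𝓘(ℝ, F →L[ℝ] ℝ)) μ) :
    mfderiv (𝓘(ℝ, EM).prod 𝓘(ℝ, F)) 𝓘(ℝ, EM) (TotalSpace.proj : TotalSpace F E → M) (h.Φ μ)
        (mfderiv (𝓘(ℝ, EM).prod 𝓘(ℝ, F →L[ℝ] ℝ)) (𝓘(ℝ, EM).prod 𝓘(ℝ, F)) h.Φ μ v) =
      mfderiv (𝓘(ℝ, EM).prod 𝓘(ℝ, F →L[ℝ] ℝ)) 𝓘(ℝ, EM)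
        (TotalSpace.proj : DualTotal F E → M) μ v := by
  have hp : MDifferentiableAt (𝓘(ℝ, EM).prod 𝓘(ℝ, F)) 𝓘(ℝ, EM)
      (TotalSpace.proj : TotalSpace F E → M) (h.Φ μ) :=
    (contMDiff_proj (n := 1) E).mdifferentiable one_ne_zero _
  exact (DFunLike.congr_fun (mfderiv_comp μ hp (h.mdifferentiableAt_Φ μ)) v).symm

/-- Since $\Phi$ covers the identity of $M$, the image is vertical, hence a vertical lift of some
`c`. Testing against the fibre coordinates identifies `c`. -/
theorem mfderiv_Φ_vertLift (μ : DualTotal F E) (β : E μ.proj →L[ℝ] ℝ) :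
    mfderiv (𝓘(ℝ, EM).prod 𝓘(ℝ, F →L[ℝ] ℝ)) (𝓘(ℝ, EM).prod 𝓘(ℝ, F)) h.Φ μ (vertLift EM μ β) =
      vertLift EM (h.Φ μ) (h.vertDeriv μ β) := by
  have hx := mem_baseSet_self (F := F) (E := E) μ.proj
  obtain ⟨c, hc⟩ := exists_vertLift_eq
    ((h.mfderiv_proj_Φ μ (vertLift EM μ β)).trans (mfderiv_proj_vertLift μ β))
  have hm : ContMDiffAt (𝓘(ℝ, EM).prod 𝓘(ℝ, F)) 𝓘(ℝ, F) ∞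
      (fun z : TotalSpace F E ↦ coordAt F μ.proj z.2) (h.Φ μ) :=
    contMDiffAt_coordAt (p := fun z : TotalSpace F E ↦ z.proj) hx contMDiffAt_id
  have h1 := dirDeriv_comp (hm.mdifferentiableAt (by simp)) (h.mdifferentiableAt_Φ μ)
    (vertLift EM μ β)
  rw [← hc] at h1 ⊢
  have h2 : c = h.vertDeriv μ β := coordAt_injective hx <|
    (dirDeriv_coordAt_vertLift (EM := EM) (h.Φ μ) c).symm.trans
      (h1.symm.trans (coordAt_ofCoord hx _).symm)
  rw [h2]

variable (A) in
/-- The prolonged tangent map on a fibre, as a linear isomorphism. -/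
def pushEquiv (μ : DualTotal F E) : A.TEdual μ ≃ₗ[ℝ] A.TE (h.Φ μ) :=
  LinearEquiv.ofBijective
    { toFun := h.pushforward A μ
      map_add' := fun a b ↦ Subtype.ext (Prod.ext rfl (ContinuousLinearMap.map_add _ a.1.2 b.1.2))
      map_smul' := fun c a ↦ Subtype.ext (Prod.ext rfl (ContinuousLinearMap.map_smul _ c a.1.2)) } <| by
    obtain ⟨e, he⟩ := h.isInvertible_mfderiv_Φ μ
    constructor
    · intro a b hab
      have h1 : a.1.1 = b.1.1 := congrArg (fun c : A.TE (h.Φ μ) ↦ c.1.1) hab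
      have h2 : mfderiv (𝓘(ℝ, EM).prod 𝓘(ℝ, F →L[ℝ] ℝ)) (𝓘(ℝ, EM).prod 𝓘(ℝ, F)) h.Φ μ a.1.2 =
          mfderiv (𝓘(ℝ, EM).prod 𝓘(ℝ, F →L[ℝ] ℝ)) (𝓘(ℝ, EM).prod 𝓘(ℝ, F)) h.Φ μ b.1.2 :=
        congrArg (fun c : A.TE (h.Φ μ) ↦ c.1.2) hab
      rw [← he] at h2
      exact Subtype.ext (Prod.ext h1 (e.injective h2))
    · intro b
      obtain ⟨v, hv⟩ := e.surjective b.1.2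
      have hv' : mfderiv (𝓘(ℝ, EM).prod 𝓘(ℝ, F →L[ℝ] ℝ)) (𝓘(ℝ, EM).prod 𝓘(ℝ, F)) h.Φ μ v =
          b.1.2 := (DFunLike.congr_fun he.symm v).trans hv
      refine ⟨⟨(b.1.1, v), ?_⟩, Subtype.ext (Prod.ext rfl hv')⟩
      refine (LieAlgebroid.anchor_fst b).trans ?_
      rw [← hv']
      exact h.mfderiv_proj_Φ μ v

theorem pushEquiv_apply (μ : DualTotal F E) (a : A.TEdual μ) :
    h.pushEquiv A μ a = h.pushforward A μ a := rfl

theorem pushforward_neg (μ : DualTotal F E) (a : A.TEdual μ) :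
    h.pushforward A μ (-a) = -h.pushforward A μ a :=
  (h.pushEquiv A μ).toLinearMap.map_neg a

theorem pushforward_sub (μ : DualTotal F E) (a b : A.TEdual μ) :
    h.pushforward A μ (a - b) = h.pushforward A μ a - h.pushforward A μ b :=
  (h.pushEquiv A μ).toLinearMap.map_sub a b

theorem isSmooth_pushSection {ρ : ∀ μ, A.TEdual μ} (hρ : A.IsSmooth ρ) :
    A.IsSmooth (h.pushSection A ρ) where
  fst := by
    have h1 := hρ.fst.comp h.legendre.symm.contMDiff
    convert h1 using 1
    funext w
    obtain ⟨μ, rfl⟩ := h.exists_Φ_eq w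
    rw [pushSection_apply]
    exact (congrArg (fun z : DualTotal F E ↦ (⟨z.proj, (ρ z).1.1⟩ : TotalSpace F E))
      (h.legendre_symm_Φ μ)).symm
  snd := by
    have h1 := ((h.contMDiff_Φ.contMDiff_tangentMap (m := ∞) (by simp)).comp hρ.snd).comp
      h.legendre.symm.contMDiff
    convert h1 using 1
    funext w
    obtain ⟨μ, rfl⟩ := h.exists_Φ_eq w
    rw [pushSection_apply]
    exact (congrArg (fun z : DualTotal F E ↦ tangentMap (𝓘(ℝ, EM).prod 𝓘(ℝ, F →L[ℝ] ℝ))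
      (𝓘(ℝ, EM).prod 𝓘(ℝ, F)) h.Φ ⟨z, (ρ z).1.2⟩) (h.legendre_symm_Φ μ)).symm

theorem isSmooth_pushEquiv_symm {ν : ∀ w, A.TE w} (hν : A.IsSmooth ν) :
    A.IsSmooth (fun μ ↦ (h.pushEquiv A μ).symm (ν (h.Φ μ))) where
  fst := by
    convert hν.fst.comp h.contMDiff_Φ using 1
    funext μ
    have h1 := (h.pushEquiv A μ).apply_symm_apply (ν (h.Φ μ))
    have h2 : ((h.pushEquiv A μ).symm (ν (h.Φ μ))).1.1 = (ν (h.Φ μ)).1.1 :=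
      congrArg (fun c : A.TE (h.Φ μ) ↦ c.1.1) h1
    rw [h2]
    rfl
  snd := by
    have : IsManifold (𝓘(ℝ, EM).prod 𝓘(ℝ, F →L[ℝ] ℝ)) 1 (DualTotal F E) :=
      .of_le (n := ∞) (by simp)
    have : IsManifold (𝓘(ℝ, EM).prod 𝓘(ℝ, F)) 1 (TotalSpace F E) :=
      .of_le (n := ∞) (by simp)
    have h1 := hν.snd.mpullback_vectorField h.contMDiff_Φ h.isInvertible_mfderiv_Φ (by simp)
    convert h1 using 1
    funext μ
    have h2 := (h.pushEquiv A μ).apply_symm_apply (ν (h.Φ μ))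
    have h3 : mfderiv (𝓘(ℝ, EM).prod 𝓘(ℝ, F →L[ℝ] ℝ)) (𝓘(ℝ, EM).prod 𝓘(ℝ, F)) h.Φ μ
        ((h.pushEquiv A μ).symm (ν (h.Φ μ))).1.2 = (ν (h.Φ μ)).1.2 :=
      congrArg (fun c : A.TE (h.Φ μ) ↦ c.1.2) h2
    congr 1
    exact (((h.isInvertible_mfderiv_Φ μ).inverse_apply_eq).2 h3.symm).symm

/-- The prolonged tangent map is compatible with the brackets of smooth sections. -/
theorem prolBracket_pushSection {ρ₁ ρ₂ : ∀ μ, A.TEdual μ} (h₁ : A.IsSmooth ρ₁)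
    (h₂ : A.IsSmooth ρ₂) (μ : DualTotal F E) :
    A.prolBracket (h.pushSection A ρ₁) (h.pushSection A ρ₂) (h.Φ μ) =
      h.pushforward A μ (A.prolBracket ρ₁ ρ₂ μ) := by
  have hx := mem_baseSet_self (F := F) (E := E) μ.proj
  have h₁' := h.isSmooth_pushSection h₁
  have h₂' := h.isSmooth_pushSection h₂
  have hfst : ∀ {ρ : ∀ μ, A.TEdual μ}, A.IsSmooth ρ →
      ∀ v : TangentSpace (𝓘(ℝ, EM).prod 𝓘(ℝ, F →L[ℝ] ℝ)) μ,
      dirDeriv (𝓘(ℝ, EM).prod 𝓘(ℝ, F)) (fun w ↦ coordAt F μ.proj (h.pushSection A ρ w).1.1) (h.Φ μ)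
        (mfderiv (𝓘(ℝ, EM).prod 𝓘(ℝ, F →L[ℝ] ℝ)) (𝓘(ℝ, EM).prod 𝓘(ℝ, F)) h.Φ μ v) =
      dirDeriv (𝓘(ℝ, EM).prod 𝓘(ℝ, F →L[ℝ] ℝ)) (fun z ↦ coordAt F μ.proj (ρ z).1.1) μ v := by
    intro ρ hρ v
    have hc := ((h.isSmooth_pushSection hρ).coord (x₀ := μ.proj) (w := h.Φ μ)
      hx).mdifferentiableAt (by simp)
    rw [← dirDeriv_comp hc (h.mdifferentiableAt_Φ μ)]
    refine dirDeriv_congr (.of_forall fun z ↦ ?_) v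
    simp only [pushSection_apply]
    rfl
  -- The vector-field part of the pushed section pulls back to that of `ρ`, so naturality of the Lie
  -- bracket under pullback by the local diffeomorphism $\Phi$ settles the second component.
  have hsnd : ∀ ρ : ∀ μ, A.TEdual μ,
      mpullback (𝓘(ℝ, EM).prod 𝓘(ℝ, F →L[ℝ] ℝ)) (𝓘(ℝ, EM).prod 𝓘(ℝ, F)) h.Φ
        (fun w ↦ (h.pushSection A ρ w).1.2) = fun z ↦ (ρ z).1.2 := by
    intro ρ
    funext z
    rw [mpullback_apply, (h.isInvertible_mfderiv_Φ z).inverse_apply_eq, pushSection_apply]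
    rfl
  refine Subtype.ext ?_
  rw [h₁'.prolBracket_coe h₂' (isChartLinear_proj _)]
  refine Prod.ext ?_ ?_
  · have e₁ : A.bracketFst (h.pushSection A ρ₁) (h.pushSection A ρ₂) (h.Φ μ) =
        ofCoord F E μ.proj μ.proj
          (dirDeriv (𝓘(ℝ, EM).prod 𝓘(ℝ, F)) (fun w ↦ coordAt F μ.proj (h.pushSection A ρ₂ w).1.1)
            (h.Φ μ) (h.pushforward A μ (ρ₁ μ)).1.2 -
          dirDeriv (𝓘(ℝ, EM).prod 𝓘(ℝ, F)) (fun w ↦ coordAt F μ.proj (h.pushSection A ρ₁ w).1.1)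
            (h.Φ μ) (h.pushforward A μ (ρ₂ μ)).1.2) +
        A.structureMap μ.proj (ρ₁ μ).1.1 (ρ₂ μ).1.1 := by
      rw [LieAlgebroid.bracketFst_eq, pushSection_apply, pushSection_apply]
      rfl
    have e₂ : (A.prolBracket ρ₁ ρ₂ μ).1.1 = A.bracketFst ρ₁ ρ₂ μ :=
      congrArg Prod.fst (h₁.prolBracket_coe h₂ LieAlgebroid.isChartLinear_dual μ)
    refine e₁.trans (Eq.trans ?_ e₂.symm)
    rw [LieAlgebroid.bracketFst_eq, ← hfst h₁ (ρ₂ μ).1.2, ← hfst h₂ (ρ₁ μ).1.2]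
    rfl
  · have hle : ∀ n : ℕ∞, minSmoothness ℝ (n : WithTop ℕ∞) ≤ ∞ := fun n ↦ by
      simp
    have : IsManifold (𝓘(ℝ, EM).prod 𝓘(ℝ, F →L[ℝ] ℝ)) (minSmoothness ℝ 3) (DualTotal F E) :=
      .of_le (n := ∞) (hle 3)
    have : IsManifold (𝓘(ℝ, EM).prod 𝓘(ℝ, F)) (minSmoothness ℝ 3) (TotalSpace F E) :=
      .of_le (n := ∞) (hle 3)
    have h3 := mpullback_mlieBracket (h₁'.snd.mdifferentiable (by simp) (h.Φ μ))
      (h₂'.snd.mdifferentiable (by simp) (h.Φ μ)) (h.contMDiff_Φ μ) (hle 2)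
    rw [hsnd, hsnd, mpullback_apply, (h.isInvertible_mfderiv_Φ μ).inverse_apply_eq] at h3
    refine h3.trans ?_
    change _ = mfderiv _ _ h.Φ μ (A.prolBracket ρ₁ ρ₂ μ).1.2
    rw [h₁.prolBracket_coe h₂ LieAlgebroid.isChartLinear_dual]

variable {h} {𝒥 : ∀ μ, A.TEdual μ →ₗ[ℝ] A.TEdual μ}

/-- $\mathcal J$ turns $D_\beta\Phi$ into $\beta^v$ and $T\Phi$ turns $\beta^v$ into
$(D_\beta\Phi)^v$, which is what $J$ does directly. -/
theorem IsInducedStructure.pushforward_apply (h𝒥 : h.IsInducedStructure A 𝒥) (μ : DualTotal F E)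
    (a : A.TEdual μ) :
    h.pushforward A μ (𝒥 μ a) = A.J (h.Φ μ) (h.pushforward A μ a) := by
  obtain ⟨β, hβ, ha⟩ := h𝒥.exists_apply_eq μ a
  rw [hβ]
  refine Subtype.ext (Prod.ext rfl ?_)
  refine (h.mfderiv_Φ_vertLift μ β).trans ?_
  rw [← ha]
  rfl

theorem IsInducedSection.isSemispray {ρ : ∀ μ, A.TEdual μ} (hρ : h.IsInducedSection A ρ) :
    A.IsSemispray (h.pushSection A ρ) where
  smooth := h.isSmooth_pushSection hρ.smooth
  J_apply w := by
    obtain ⟨μ, rfl⟩ := h.exists_Φ_eq w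
    rw [pushSection_apply]
    exact congrArg (A.vertE (h.Φ μ)) (hρ.fst_eq μ)

variable (h) in
theorem exists_pushforward_comp (𝒩 : ∀ μ, A.TEdual μ →ₗ[ℝ] A.TEdual μ) :
    ∃ N : ∀ w, A.TE w →ₗ[ℝ] A.TE w, ∀ μ (a : A.TEdual μ),
      N (h.Φ μ) (h.pushforward A μ a) = h.pushforward A μ (𝒩 μ a) := by
  -- The conjugate of `𝒩` lives over points of the form `Φ μ`. Quantifying over all `μ` with `Φ μ =
  -- w` lets a choice be made over every `w` and then specialized with `rfl`, so no transport
  -- remains.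
  have key : ∀ w, ∃ N : A.TE w →ₗ[ℝ] A.TE w, ∀ μ (e : h.Φ μ = w) (a : A.TEdual μ),
      N (e ▸ h.pushforward A μ a) = e ▸ h.pushforward A μ (𝒩 μ a) := by
    intro w
    obtain ⟨μ, rfl⟩ := h.exists_Φ_eq w
    refine ⟨(h.pushEquiv A μ).toLinearMap ∘ₗ 𝒩 μ ∘ₗ (h.pushEquiv A μ).symm.toLinearMap,
      fun μ' e ↦ ?_⟩
    obtain rfl := h.Φ_injective e
    intro a
    change h.pushforward A μ' (𝒩 μ' ((h.pushEquiv A μ').symm (h.pushEquiv A μ' a))) = _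
    rw [LinearEquiv.symm_apply_apply]
  choose N hN using key
  exact ⟨N, fun μ a ↦ hN (h.Φ μ) μ rfl a⟩

theorem pushSection_pushEquiv_symm (ν : ∀ w, A.TE w) :
    h.pushSection A (fun μ ↦ (h.pushEquiv A μ).symm (ν (h.Φ μ))) = ν := by
  funext w
  obtain ⟨μ, rfl⟩ := h.exists_Φ_eq w
  rw [pushSection_apply]
  exact (h.pushEquiv A μ).apply_symm_apply _

/-- $\Phi_*$ is a fibrewise isomorphism which leaves the $E$-component unchanged and preserves
smooth sections in both directions, so each axiom is carried over by conjugation. -/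
theorem isConnection_of_pushforward {𝒩 : ∀ μ, A.TEdual μ →ₗ[ℝ] A.TEdual μ} (h𝒩 : A.IsConnection 𝒩)
    {N : ∀ w, A.TE w →ₗ[ℝ] A.TE w} (hN : ∀ μ (a : A.TEdual μ),
      N (h.Φ μ) (h.pushforward A μ a) = h.pushforward A μ (𝒩 μ a)) : A.IsConnection N where
  smooth ν hν := by
    have h1 := h.isSmooth_pushSection (h𝒩.smooth _ (h.isSmooth_pushEquiv_symm hν))
    convert h1 using 1
    funext w
    obtain ⟨μ, rfl⟩ := h.exists_Φ_eq w
    rw [pushSection_apply, ← hN, ← pushEquiv_apply, LinearEquiv.apply_symm_apply]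
  sq w := by
    obtain ⟨μ, rfl⟩ := h.exists_Φ_eq w
    refine LinearMap.ext fun b ↦ ?_
    obtain ⟨a, rfl⟩ := (h.pushEquiv A μ).surjective b
    rw [LinearMap.comp_apply, pushEquiv_apply, hN, hN, ← LinearMap.comp_apply, h𝒩.sq]
    rfl
  ker w b := by
    obtain ⟨μ, rfl⟩ := h.exists_Φ_eq w
    obtain ⟨a, rfl⟩ := (h.pushEquiv A μ).surjective b
    refine Iff.trans ?_ (h𝒩.ker μ a)
    rw [LinearMap.mem_ker, LinearMap.mem_ker, LinearMap.add_apply, LinearMap.add_apply,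
      pushEquiv_apply, hN, ← pushEquiv_apply, ← pushEquiv_apply, LinearMap.id_apply,
      LinearMap.id_apply, ← LinearEquiv.map_add, LinearEquiv.map_eq_zero_iff]

theorem IsInducedStructure.pushforward_lieDerivative (h𝒥 : h.IsInducedStructure A 𝒥)
    {ρ : ∀ μ, A.TEdual μ} (hρ : A.IsSmooth ρ) {ν : ∀ w, A.TEdual w} (hν : A.IsSmooth ν)
    (μ : DualTotal F E) :
    h.pushforward A μ (A.lieDerivative ρ (fun z ↦ 𝒥 z) ν μ) =
      A.lieDerivative (h.pushSection A ρ) A.J (h.pushSection A ν) (h.Φ μ) := by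
  have h1 : (fun w ↦ A.J w (h.pushSection A ν w)) = h.pushSection A (fun z ↦ 𝒥 z (ν z)) := by
    funext w
    obtain ⟨μ, rfl⟩ := h.exists_Φ_eq w
    rw [pushSection_apply, pushSection_apply, h𝒥.pushforward_apply]
  rw [LieAlgebroid.lieDerivative, LieAlgebroid.lieDerivative, h1,
    h.prolBracket_pushSection hρ (h𝒥.adapted.smooth ν hν), h.prolBracket_pushSection hρ hν,
    ← h𝒥.pushforward_apply, pushforward_sub]

end HyperregularHamiltonian

end

end

/-! ### The main theorem -/

theorem theorem1p5p3
    {EM : Type*} [NormedAddCommGroup EM] [NormedSpace ℝ EM] [FiniteDimensional ℝ EM]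
    {M : Type*} [TopologicalSpace M] [ChartedSpace EM M] [IsManifold 𝓘(ℝ, EM) ∞ M] [T2Space M]
    {F : Type*} [NormedAddCommGroup F] [NormedSpace ℝ F] [FiniteDimensional ℝ F]
    {E : M → Type*} [TopologicalSpace (TotalSpace F E)]
    [∀ x, AddCommGroup (E x)] [∀ x, Module ℝ (E x)] [∀ x, TopologicalSpace (E x)]
    [FiberBundle F E] [VectorBundle ℝ F E] [ContMDiffVectorBundle ∞ F E 𝓘(ℝ, EM)]
    (A : LieAlgebroid EM F E) (h : HyperregularHamiltonian EM F E)
    (𝒥 : ∀ μ, A.TEdual μ →ₗ[ℝ] A.TEdual μ) (h𝒥 : h.IsInducedStructure A 𝒥)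
    (ρ : ∀ μ, A.TEdual μ) (hρ : h.IsInducedSection A ρ) :
    A.IsRegular 𝒥 ρ ∧
    A.IsSemispray (h.pushSection A ρ) ∧
    ∃ (𝒩 : ∀ μ, A.TEdual μ →ₗ[ℝ] A.TEdual μ) (N : ∀ w, A.TE w →ₗ[ℝ] A.TE w),
      A.IsConnection 𝒩 ∧ A.IsConnection N ∧
      (∀ ν : ∀ μ, A.TEdual μ, A.IsSmooth ν → ∀ μ,
        𝒩 μ (ν μ) = -A.lieDerivative ρ (fun z ↦ 𝒥 z) ν μ) ∧
      (∀ ν : ∀ w, A.TE w, A.IsSmooth ν → ∀ w,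
        N w (ν w) = -A.lieDerivative (h.pushSection A ρ) A.J ν w) ∧
      ∀ (μ : DualTotal F E) (a : A.TEdual μ),
        N (h.Φ μ) (h.pushforward A μ a) = h.pushforward A μ (𝒩 μ a) := by

  obtain ⟨𝒩, h𝒩⟩ := h𝒥.exists_linear hρ
  obtain ⟨N, hN⟩ := h.exists_pushforward_comp 𝒩
  have hc := h𝒥.isConnection hρ h𝒩
  refine ⟨h𝒥.isRegular hρ, hρ.isSemispray, 𝒩, N, hc,
    HyperregularHamiltonian.isConnection_of_pushforward hc hN, h𝒩, fun ν hν w ↦ ?_, hN⟩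
  obtain ⟨μ, rfl⟩ := h.exists_Φ_eq w
  have hν' := h.isSmooth_pushEquiv_symm hν
  -- Every smooth section of $\mathcal TE$ is the pushforward of a smooth section of $\mathcal
  -- TE^*$, so the formula for `N` follows from the one for `𝒩`.
  rw [← HyperregularHamiltonian.pushSection_pushEquiv_symm (h := h) ν,
    h.pushSection_apply, hN, h𝒩 _ hν', h.pushforward_neg,
    h𝒥.pushforward_lieDerivative hρ.smooth hν']
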